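/- Let $X$ be a complex Banach space and let $-A\colon \mathsf D(A)\subseteq X\to X$ generate a uniformly bounded strongly measurable semigroup $(S(t))_{t\ge 0}\subset\mathscr L(X)$ with $S(0)=\mathrm{id}_X$ (strong continuity at $0$ is not required; "generate" means that, for all $z\in\mathbb C$ with sufficiently large real part, $z+A\colon\mathsf D(A)\to X$ is bijective with inverse $x\mapsto\int_0^\infty e^{-zt}S(t)x\,\mathrm dt$). Let $s\in(0,\infty)\setminus\mathbb N$, $n:=\lceil s\rceil$, $\{s\}:=s-\lfloor s\rfloor$, $t_0\in\mathbb R$, $J:=(t_0,\infty)$ and $p\in[1,\infty]$. For $\sigma>0$ put $$\mathfrak I^\sigma_{t_0}u(t):=\frac1{\Gamma(\sigma)}\int_{t_0}^t(t-\tau)^{\sigma-1}S(t-\tau)u(\tau)\,\mathrm d\tau ,\qquad \mathfrak I^0_{t_0}u:=u .$$ View $\partial_t+A$ as an operator on $L^p(J;X)$ with domain $W^{1,p}(J;X)\cap L^p(J;\mathsf D(A))$, where $\partial_t$ is the weak derivative. For $r>0$ define $$\mathfrak D^r_{\mathrm{RL}}:=(\partial_t+A)^{\lceil r\rceil}\,\mathfrak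 I_{t_0}^{\lceil r\rceil-r},\qquad \mathfrak D^r_{\mathrm C}:=\mathfrak I_{t_0}^{\lceil r\rceil-r}\,(\partial_t+A)^{\lceil r\rceil},$$ where $u\in\mathsf D(\mathfrak D^r_{\mathrm{RL}})$ means $u\in L^p(J;X)$ and $\mathfrak I_{t_0}^{\lceil r\rceil-r}u\in\mathsf D((\partial_t+A)^{\lceil r\rceil})$, and $u\in\mathsf D(\mathfrak D^r_{\mathrm C})$ means $u\in\mathsf D((\partial_t+A)^{\lceil r\rceil})$. (i) If $u\in\mathsf D(\mathfrak D^s_{\mathrm{RL}})$, then $\mathfrak I_{t_0}^{1-\{s\}}u$ has a continuous representative on $\overline J=[t_0,\infty)$, and for $k\in\{1,\dots,\lfloor s\rfloor\}$ we have $u\in\mathsf D(\mathfrak D^{k+\{s\}-1}_{\mathrm{RL}})$ and $\mathfrak D_{\mathrm{RL}}^{k+\{s\}-1}u$ has a continuous representative on $\overline J$. Denoting the values of these representatives at $t_0$ by $\mathfrak I_{t_0}^{1-\{s\}}u(t_0)$ and $\mathfrak D_{\mathrm{RL}}^{k+\{s\}-1}u(t_0)$, for almost all $t\in J$ the integral defining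 $\mathfrak I^s_{t_0}\mathfrak D^s_{\mathrm{RL}}u(t)$ converges and $$\mathfrak I^s_{t_0}\mathfrak D^s_{\mathrm{RL}}u(t)=u(t)-\frac{(t-t_0)^{\{s\}-1}}{\Gamma(\{s\})}S(t-t_0)\,\mathfrak I_{t_0}^{1-\{s\}}u(t_0)-\sum_{k=1}^{\lfloor s\rfloor}\frac{(t-t_0)^{k+\{s\}-1}}{\Gamma(k+\{s\})}S(t-t_0)\,\mathfrak D_{\mathrm{RL}}^{k+\{s\}-1}u(t_0).$$ (ii) If $u\in\mathsf D(\mathfrak D^s_{\mathrm C})$ and $u\in C^j(\overline J;\mathsf D(A^{n-1-j}))$ for all $j\in\{0,\dots,n-1\}$, where $\mathsf D(A^m)$ carries its graph norm, then $u^{(k)}(t_0)\in\mathsf D(A^{n-1-k})$ for all $k\in\{0,\dots,\lfloor s\rfloor\}$, and for almost all $t\in J$ the integral defining $\mathfrak I^s_{t_0}\mathfrak D^s_{\mathrm C}u(t)$ converges and $$\mathfrak I^s_{t_0}\mathfrak D^s_{\mathrm C}u(t)=u(t)-\sum_{k=0}^{\lfloor s\rfloor}\frac{(t-t_0)^k}{k!}\,\overline\Gamma(\lceil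 s\rceil-k,(t-t_0)A)\,u^{(k)}(t_0),$$ where for $m\in\mathbb N$, $t>0$ and $x\in\mathsf D(A^{m-1})$ we set $\overline\Gamma(m,tA)x:=\sum_{l=0}^{m-1}\frac{t^l}{l!}A^lS(t)x$. -/

import Mathlib

open MeasureTheory Set Filter Topology
open scoped ENNReal ContDiff

noncomputable section

namespace FracParabolic

variable {X : Type*} [NormedAddCommGroup X] [NormedSpace ℂ X]

/-- A locally bounded strongly measurable semigroup `(S(t))_{t ≥ 0}` of bounded operators on `X`.
The operators `S t` with `t < 0` play no role. -/
structure IsMeasurableSemigroup (S : ℝ → X →L[ℂ] X) : Prop where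
  map_zero : S 0 = ContinuousLinearMap.id ℂ X
  map_add : ∀ r t : ℝ, 0 ≤ r → 0 ≤ t → S (r + t) = (S r).comp (S t)
  stronglyMeasurable : ∀ x : X, AEStronglyMeasurable (fun t => S t x) (volume.restrict (Ici 0))
  locallyBounded : ∀ T : ℝ, ∃ M : ℝ, ∀ t ∈ Icc 0 T, ‖S t‖ ≤ M

/-- Uniform boundedness of the semigroup. -/
def IsUniformlyBounded (S : ℝ → X →L[ℂ] X) : Prop :=
  ∃ M : ℝ, ∀ t : ℝ, 0 ≤ t → ‖S t‖ ≤ M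

/-- The Laplace transform `∫_0^∞ e^{-zt} S(t) x dt` of the semigroup. -/
def laplace (S : ℝ → X →L[ℂ] X) (z : ℂ) (x : X) : X :=
  ∫ t in Ioi (0 : ℝ), Complex.exp (-z * t) • S t x

/-- `-A` is the infinitesimal generator of the strongly measurable semigroup `S`: on some right
half-plane, `z + A : D(A) → X` is a bijection whose inverse is the Laplace transform of `S`.
(For strongly continuous semigroups this is equivalent to the description of the generator by the
derivative at zero; for semigroups that are not strongly continuous at zero this is the
definition of the generator.) -/
def IsNegGenerator (S : ℝ → X →L[ℂ] X) (A : X →ₗ.[ℂ] X) : Prop :=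
  ∃ w : ℝ, ∀ z : ℂ, w < z.re →
    (∀ x : X, ∃ h : laplace S z x ∈ A.domain,
      z • laplace S z x + A ⟨laplace S z x, h⟩ = x) ∧
    (∀ x : A.domain, laplace S z (z • (x : X) + A x) = x)

open Classical in
/-- `A x` for `x ∈ D(A)` (and `0` otherwise). -/
def opApply (A : X →ₗ.[ℂ] X) (x : X) : X :=
  if h : x ∈ A.domain then A ⟨x, h⟩ else 0

/-- `A^m x`, meaningful for `x ∈ D(A^m)`. -/
def opPow (A : X →ₗ.[ℂ] X) (m : ℕ) (x : X) : X :=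
  (opApply A)^[m] x

/-- The domain `D(A^m)`. -/
def domPow (A : X →ₗ.[ℂ] X) (m : ℕ) : Set X :=
  {x | ∀ l < m, opPow A l x ∈ A.domain}

/-- The integrand `τ ↦ (t - τ)^{σ - 1} S(t - τ) u(τ)` of the fractional parabolic integral. -/
def fracIntegrand (S : ℝ → X →L[ℂ] X) (σ : ℝ) (u : ℝ → X) (t τ : ℝ) : X :=
  (t - τ) ^ (σ - 1) • S (t - τ) (u τ)

/-- The Riemann–Liouville type fractional parabolic integral of order `σ` on `(t₀, ∞)`,
`(1 / Γ(σ)) ∫_{t₀}^t (t - τ)^{σ - 1} S(t - τ) u(τ) dτ` for `σ > 0`, and `u` for `σ = 0`. -/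
def fracInt (S : ℝ → X →L[ℂ] X) (t₀ σ : ℝ) (u : ℝ → X) (t : ℝ) : X :=
  if σ = 0 then u t
  else (1 / Real.Gamma σ) • ∫ τ in Ioo t₀ t, fracIntegrand S σ u t τ

/-- `v` is the weak derivative of `u` on `(t₀, ∞)`. -/
def IsWeakDeriv (t₀ : ℝ) (u v : ℝ → X) : Prop :=
  ∀ φ : ℝ → ℝ, ContDiff ℝ ∞ φ → HasCompactSupport φ → tsupport φ ⊆ Ioi t₀ →
    ∫ t in Ioi t₀, deriv φ t • u t = - ∫ t in Ioi t₀, φ t • v t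

/-- `u` belongs to the domain `W^{1,p}(J; X) ∩ L^p(J; D(A))` of `∂_t + A` on `L^p(J; X)`,
`J = (t₀, ∞)`, and `(∂_t + A) u = f` (almost everywhere). -/
def IsParabolic (A : X →ₗ.[ℂ] X) (p : ℝ≥0∞) (t₀ : ℝ) (u f : ℝ → X) : Prop :=
  MemLp u p (volume.restrict (Ioi t₀)) ∧
  (∀ᵐ t ∂volume.restrict (Ioi t₀), u t ∈ A.domain) ∧
  MemLp (fun t => opApply A (u t)) p (volume.restrict (Ioi t₀)) ∧
  ∃ v : ℝ → X, MemLp v p (volume.restrict (Ioi t₀)) ∧ IsWeakDeriv t₀ u v ∧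
    f =ᵐ[volume.restrict (Ioi t₀)] fun t => v t + opApply A (u t)

/-- `u` belongs to the domain of `(∂_t + A)^n` on `L^p(J; X)`, and `(∂_t + A)^n u = f`. -/
def IsParabolicPow (A : X →ₗ.[ℂ] X) (p : ℝ≥0∞) (t₀ : ℝ) : ℕ → (ℝ → X) → (ℝ → X) → Prop
  | 0, u, f => MemLp u p (volume.restrict (Ioi t₀)) ∧ f =ᵐ[volume.restrict (Ioi t₀)] u
  | n + 1, u, f => ∃ g : ℝ → X, IsParabolic A p t₀ u g ∧ IsParabolicPow A p t₀ n g f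

/-- `u ∈ L^p(J; X)` belongs to the (maximal) domain of the Riemann–Liouville type derivative
`(∂_t + A)^⌈s⌉ I^{⌈s⌉ - s}` of order `s`, and `f` is (a representative of) that derivative. -/
def IsRLDeriv (S : ℝ → X →L[ℂ] X) (A : X →ₗ.[ℂ] X) (p : ℝ≥0∞) (t₀ s : ℝ)
    (u f : ℝ → X) : Prop :=
  MemLp u p (volume.restrict (Ioi t₀)) ∧
  IsParabolicPow A p t₀ ⌈s⌉₊ (fracInt S t₀ (⌈s⌉₊ - s) u) f

/-- `u ∈ L^p(J; X)` belongs to the (maximal) domain of the Caputo type derivative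
`I^{⌈s⌉ - s} (∂_t + A)^⌈s⌉` of order `s`, and `f` is (a representative of) that derivative. -/
def IsCaputoDeriv (S : ℝ → X →L[ℂ] X) (A : X →ₗ.[ℂ] X) (p : ℝ≥0∞) (t₀ s : ℝ)
    (u f : ℝ → X) : Prop :=
  ∃ g : ℝ → X, IsParabolicPow A p t₀ ⌈s⌉₊ u g ∧
    f =ᵐ[volume.restrict (Ioi t₀)] fracInt S t₀ (⌈s⌉₊ - s) g

/-- `u ∈ C^j([t₀, ∞); D(A^m))`, where `D(A^m)` carries the graph norm
`‖x‖ + ‖A x‖ + ⋯ + ‖A^m x‖`. -/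
def IsCkDomPow (A : X →ₗ.[ℂ] X) (t₀ : ℝ) (j m : ℕ) (u : ℝ → X) : Prop :=
  (∀ t ∈ Ici t₀, u t ∈ domPow A m) ∧
  ∀ l ≤ m, ContDiffOn ℝ j (fun t => opPow A l (u t)) (Ici t₀)

/-- The operator-valued normalized upper incomplete gamma function of integer order `n ≥ 1`,
`Γ̄(n, tA) x = ∑_{l=0}^{n-1} (t^l / l!) A^l S(t) x` for `t > 0` and `x ∈ D(A^{n-1})`,
with `Γ̄(n, 0A) x = x`. -/
def incGammaOp (S : ℝ → X →L[ℂ] X) (A : X →ₗ.[ℂ] X) (n : ℕ) (t : ℝ) (x : X) : X :=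
  if t = 0 then x
  else ∑ l ∈ Finset.range n, (t ^ l / (l.factorial : ℝ)) • opPow A l (S t x)

end FracParabolic

end

open FracParabolic

/-! Write N = ⌊s⌋, θ = {s}, n = N + 1, and I^σ for Volterra convolution with r^{σ-1} S(r) / Γ(σ), so
that I^1 is convolution with S. The engine is variation of constants: (∂_t + A) w = f forces w = S(·
- t₀) w(t₀) + I^1 f. The index law I^a I^b = I^{a+b} (semigroup law plus Euler's beta integral)
allows iteration, and for (∂_t + A)^n w = f one gets w(t) = ∑_{k<n} (t - t₀)^k / k! · S(t - t₀)
g_k(t₀) + I^n f(t), with g_k the continuous representative of (∂_t + A)^k w. This is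
`FracParabolic.IsParabolicPow.exists_expansion`.

Riemann–Liouville case: take w = I^{1-θ} u. Every term on the right is itself I^{1-θ} of something:
the k-th is the image of (t - t₀)^{k+θ-1} / Γ(k+θ) · S(t - t₀) g_k(t₀), and I^n f = I^{1-θ} I^s f.
Since I^{1-θ} is injective, it can be cancelled, which is the claim.

Caputo case: take w = u and (∂_t + A)^n u = g. Then I^s I^{1-θ} g = I^n g is already the remainder
of the expansion. It remains to identify g_k(t₀): by uniqueness of continuous representatives, g_k
is the binomial sum of the A^l u^{(i)} with i + l = k, and regrouping by i produces the incomplete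
gamma operators.

Without strong continuity at 0, orbits S(·)x may be merely measurable. Differentiation is therefore
replaced by integrated identities holding almost everywhere, and a resolvent R = (z + A)⁻¹, which is
injective and commutes with S, moves data into D(A), where orbits are continuous. Injectivity of I^α
with 0 < α < 1 reduces by I^{1-α} I^α = I^1 to that of convolution with S, and the latter to
injectivity of the primitive. The weight e^{-t} places L^p data for all p ≥ 1, and all kernels, in
one L^1 convolution theory on ℝ. -/

open FracParabolic

/-! ### Fubini for operator-valued convolutions on the line. -/

section OperatorConvolution

variable {X : Type*} [NormedAddCommGroup X] [NormedSpace ℂ X]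

/-- Joint measurability of `(r, a) ↦ K r (F a)` for strongly measurable `K` and `F`. -/
theorem aestronglyMeasurable_clm_apply_prod {α β : Type*} [MeasurableSpace α] [MeasurableSpace β]
    {μ : Measure α} {ν : Measure β} [SFinite μ] [SFinite ν] {K : β → X →L[ℂ] X} {F : α → X}
    (hK : ∀ x, AEStronglyMeasurable (fun r => K r x) ν) (hF : AEStronglyMeasurable F μ) :
    AEStronglyMeasurable (fun q : α × β => K q.2 (F q.1)) (μ.prod ν) := by
  obtain ⟨G, hG, hFG⟩ := hF
  have hae : (fun q : α × β => K q.2 (G q.1)) =ᵐ[μ.prod ν] fun q => K q.2 (F q.1) := by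
    have := (Measure.quasiMeasurePreserving_fst (μ := μ) (ν := ν)).ae hFG
    filter_upwards [this] with q hq
    rw [hq]
  refine AEStronglyMeasurable.congr ?_ hae
  -- For simple F the map is a finite sum of indicators times orbits K r y, so strong measurability
  -- of K suffices; continuity of each K r passes to the limit.
  refine aestronglyMeasurable_of_tendsto_ae atTop
    (f := fun n (q : α × β) => K q.2 (hG.approx n q.1)) (fun n => ?_) ?_
  · have : (fun q : α × β => K q.2 (hG.approx n q.1)) =
        fun q => ∑ y ∈ (hG.approx n).range,
          ((hG.approx n) ⁻¹' {y}).indicator (fun _ => (1 : ℝ)) q.1 • K q.2 y := by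
      ext q
      rw [Finset.sum_eq_single (hG.approx n q.1)]
      · simp
      · intro y _ hy
        have hq : q.1 ∉ (hG.approx n) ⁻¹' {y} := by simpa [eq_comm] using hy
        simp only [indicator_of_notMem hq, zero_smul]
      · intro h
        simp at h
    rw [this]
    refine Finset.aestronglyMeasurable_fun_sum _ fun y _ => ?_
    have hm : Measurable (((hG.approx n) ⁻¹' {y}).indicator fun _ => (1 : ℝ)) :=
      measurable_const.indicator ((hG.approx n).measurableSet_fiber y)
    exact (hm.comp measurable_fst).aestronglyMeasurable.smul (hK y).comp_snd
  · refine Eventually.of_forall fun q => ?_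
    exact ((K q.2).continuous.tendsto _).comp (hG.tendsto_approx q.1)

/-- The integrand of an operator-valued convolution is integrable on the product space. -/
theorem integrable_clm_sub_apply_prod {α : Type*} [MeasurableSpace α] {μ : Measure α} [SFinite μ]
    {K : ℝ → X →L[ℂ] X} {κ : ℝ → ℝ} {F : α → X} {g : α → ℝ}
    (hK : ∀ x, AEStronglyMeasurable (fun r => K r x) volume) (hκ : Integrable κ)
    (hKκ : ∀ r, ‖K r‖ ≤ κ r) (hF : Integrable F μ) (hg : Measurable g) :
    Integrable (fun q : α × ℝ => K (q.2 - g q.1) (F q.1)) (μ.prod volume) := by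
  have h1 : Integrable (fun q : α × ℝ => K q.2 (F q.1)) (μ.prod volume) := by
    refine (hF.norm.mul_prod hκ).mono'
      (aestronglyMeasurable_clm_apply_prod hK hF.aestronglyMeasurable) ?_
    refine Eventually.of_forall fun q => ?_
    calc ‖K q.2 (F q.1)‖ ≤ ‖K q.2‖ * ‖F q.1‖ := (K q.2).le_opNorm _
      _ ≤ κ q.2 * ‖F q.1‖ := by gcongr; exact hKκ _
      _ = ‖F q.1‖ * κ q.2 := mul_comm _ _
  -- The shear (a, t) ↦ (a, t - g a) preserves the product measure, so the convolution integrand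
  -- inherits integrability from the tensor product.
  have h2 : MeasurePreserving (fun q : α × ℝ => (q.1, q.2 - g q.1)) (μ.prod volume)
      (μ.prod volume) := by
    refine (MeasurePreserving.id μ).skew_product (g := fun a t => t - g a) ?_ ?_
    · exact measurable_snd.sub (hg.comp measurable_fst)
    · refine Eventually.of_forall fun a => ?_
      exact (measurePreserving_sub_right volume (g a)).map_eq
  exact h2.integrable_comp_of_integrable h1

/-- Associativity of operator-valued convolutions on the real line. -/
theorem ae_integral_clm_comp_eq [CompleteSpace X] {K L : ℝ → X →L[ℂ] X} {κ l : ℝ → ℝ} {u : ℝ → X}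
    (hK : ∀ x, AEStronglyMeasurable (fun r => K r x) volume) (hκ : Integrable κ)
    (hKκ : ∀ r, ‖K r‖ ≤ κ r)
    (hL : ∀ x, AEStronglyMeasurable (fun r => L r x) volume) (hl : Integrable l)
    (hLl : ∀ r, ‖L r‖ ≤ l r) (hu : Integrable u) :
    ∀ᵐ t, ∫ τ, K (t - τ) (∫ ρ, L (τ - ρ) (u ρ)) = ∫ ρ, ∫ σ, K (t - ρ - σ) (L σ (u ρ)) := by
  -- Using the integrability lemma twice, the second time over pairs (ρ, τ), makes the triple
  -- integrand integrable on ℝ³; almost every slice in t then admits Fubini.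
  have hG := integrable_clm_sub_apply_prod (g := id) hL hl hLl hu measurable_id
  have hH := integrable_clm_sub_apply_prod (g := Prod.snd) hK hκ hKκ hG measurable_snd
  filter_upwards [hH.prod_left_ae] with t ht
  have hsw := integral_integral_swap (f := fun ρ τ => K (t - τ) (L (τ - ρ) (u ρ))) ht
  have h1 : ∫ τ, K (t - τ) (∫ ρ, L (τ - ρ) (u ρ)) = ∫ τ, ∫ ρ, K (t - τ) (L (τ - ρ) (u ρ)) := by
    refine integral_congr_ae ?_
    filter_upwards [hG.prod_left_ae] with τ hτ
    exact ((K (t - τ)).integral_comp_comm hτ).symm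
  rw [h1, ← hsw]
  refine integral_congr_ae (Eventually.of_forall fun ρ => ?_)
  show ∫ τ, K (t - τ) (L (τ - ρ) (u ρ)) = ∫ σ, K (t - ρ - σ) (L σ (u ρ))
  rw [← integral_add_right_eq_self _ ρ]
  refine integral_congr_ae (Eventually.of_forall fun σ => ?_)
  simp only [add_sub_cancel_right]
  congr 2
  ring

end OperatorConvolution

/-! ### Exponentially weighted Volterra convolutions. -/

section Volterra

variable {X : Type*} [NormedAddCommGroup X] [NormedSpace ℂ X]

/-- Integrability on `(t₀, ∞)` with respect to the weight `e^{-t}`. -/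
def ExpIntegrable (t₀ : ℝ) (u : ℝ → X) : Prop :=
  IntegrableOn (fun t => Real.exp (-t) • u t) (Ioi t₀)

/-- Strongly measurable operator kernels on `(0, ∞)` whose norm has an integrable majorant with
respect to the weight `e^{-r}`. -/
structure IsConvKernel (K : ℝ → X →L[ℂ] X) : Prop where
  meas : ∀ x, AEStronglyMeasurable (fun r => K r x) (volume.restrict (Ioi 0))
  bound : ∃ κ : ℝ → ℝ, IntegrableOn (fun r => Real.exp (-r) * κ r) (Ioi 0) ∧
    ∀ r, 0 < r → ‖K r‖ ≤ κ r

/-- The Volterra convolution `∫_{t₀}^t K(t - τ) u(τ) dτ`. -/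
noncomputable def volterra (K : ℝ → X →L[ℂ] X) (t₀ : ℝ) (u : ℝ → X) (t : ℝ) : X :=
  ∫ τ in Ioo t₀ t, K (t - τ) (u τ)

/-- The kernel `e^{-r} K(r)`, extended by zero to the real line. -/
noncomputable def expKernel (K : ℝ → X →L[ℂ] X) : ℝ → X →L[ℂ] X :=
  (Ioi 0).indicator fun r => Real.exp (-r) • K r

/-- The function `e^{-t} u(t)` on `(t₀, ∞)`, extended by zero to the real line. -/
noncomputable def expFun (t₀ : ℝ) (u : ℝ → X) : ℝ → X :=
  (Ioi t₀).indicator fun t => Real.exp (-t) • u t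

theorem ExpIntegrable.integrable_expFun {t₀ : ℝ} {u : ℝ → X} (hu : ExpIntegrable t₀ u) :
    Integrable (expFun t₀ u) :=
  IntegrableOn.integrable_indicator hu measurableSet_Ioi

theorem volterra_of_le (K : ℝ → X →L[ℂ] X) {t₀ t : ℝ} (u : ℝ → X) (h : t ≤ t₀) :
    volterra K t₀ u t = 0 := by
  simp [volterra, Ioo_eq_empty (not_lt.2 h)]

/-- Since e^{-(t-τ)} e^{-τ} = e^{-t}, weighting kernel and function only multiplies the convolution
by e^{-t}; extension by zero turns the Volterra integral into one over ℝ. -/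
theorem expKernel_sub_apply (K : ℝ → X →L[ℂ] X) (t₀ : ℝ) (u : ℝ → X) (t τ : ℝ) :
    expKernel K (t - τ) (expFun t₀ u τ) =
      (Ioo t₀ t).indicator (fun τ => Real.exp (-t) • K (t - τ) (u τ)) τ := by
  by_cases h1 : t₀ < τ
  · by_cases h2 : τ < t
    · rw [indicator_of_mem (show τ ∈ Ioo t₀ t from ⟨h1, h2⟩), expKernel,
        indicator_of_mem (show t - τ ∈ Ioi 0 from sub_pos.2 h2), expFun,
        indicator_of_mem (show τ ∈ Ioi t₀ from h1), _root_.smul_apply,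
        (K (t - τ)).map_smul_of_tower, smul_smul, ← Real.exp_add]
      congr 2
      ring
    · rw [indicator_of_notMem (show τ ∉ Ioo t₀ t from fun h => h2 h.2), expKernel,
        indicator_of_notMem (show t - τ ∉ Ioi (0 : ℝ) from fun h => h2 (sub_pos.1 h))]
      simp
  · rw [indicator_of_notMem (show τ ∉ Ioo t₀ t from fun h => h1 h.1), expFun,
      indicator_of_notMem (show τ ∉ Ioi t₀ from h1), map_zero]

theorem integral_expKernel (K : ℝ → X →L[ℂ] X) (t₀ : ℝ) (u : ℝ → X) (t : ℝ) :
    ∫ τ, expKernel K (t - τ) (expFun t₀ u τ) = Real.exp (-t) • volterra K t₀ u t := by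
  simp_rw [expKernel_sub_apply]
  rw [integral_indicator measurableSet_Ioo, integral_smul, volterra]

theorem integral_expKernel_eq_expFun (K : ℝ → X →L[ℂ] X) (t₀ : ℝ) (u : ℝ → X) (t : ℝ) :
    ∫ τ, expKernel K (t - τ) (expFun t₀ u τ) = expFun t₀ (volterra K t₀ u) t := by
  rw [integral_expKernel, expFun]
  by_cases h : t₀ < t
  · rw [indicator_of_mem (show t ∈ Ioi t₀ from h)]
  · rw [indicator_of_notMem (show t ∉ Ioi t₀ from h), volterra_of_le K u (not_lt.1 h), smul_zero]

namespace IsConvKernel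

variable {K L : ℝ → X →L[ℂ] X}

theorem aestronglyMeasurable_expKernel (hK : IsConvKernel K) (x : X) :
    AEStronglyMeasurable (fun r => expKernel K r x) volume := by
  have : (fun r => expKernel K r x) = (Ioi 0).indicator fun r => Real.exp (-r) • K r x := by
    ext r
    by_cases h : 0 < r
    · simp [expKernel, h]
    · simp [expKernel, h]
  rw [this, aestronglyMeasurable_indicator_iff measurableSet_Ioi]
  exact (by fun_prop : Continuous fun r : ℝ => Real.exp (-r)).aestronglyMeasurable.smul (hK.meas x)

theorem exists_bound_expKernel (hK : IsConvKernel K) :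
    ∃ κ : ℝ → ℝ, Integrable κ ∧ ∀ r, ‖expKernel K r‖ ≤ κ r := by
  obtain ⟨κ, hκ, hb⟩ := hK.bound
  refine ⟨(Ioi 0).indicator fun r => Real.exp (-r) * κ r,
    IntegrableOn.integrable_indicator hκ measurableSet_Ioi, fun r => ?_⟩
  rw [expKernel, norm_indicator_eq_indicator_norm]
  refine indicator_le_indicator' fun h => ?_
  rw [norm_smul, Real.norm_eq_abs, abs_of_pos (Real.exp_pos _)]
  exact mul_le_mul_of_nonneg_left (hb r h) (Real.exp_pos _).le

theorem integrable_prod (hK : IsConvKernel K) {t₀ : ℝ} {u : ℝ → X} (hu : ExpIntegrable t₀ u) :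
    Integrable (fun q : ℝ × ℝ => expKernel K (q.2 - q.1) (expFun t₀ u q.1))
      (volume.prod volume) := by
  obtain ⟨κ, hκ, hb⟩ := hK.exists_bound_expKernel
  exact integrable_clm_sub_apply_prod (g := id) hK.aestronglyMeasurable_expKernel hκ hb
    hu.integrable_expFun measurable_id

theorem ae_integrableOn (hK : IsConvKernel K) {t₀ : ℝ} {u : ℝ → X} (hu : ExpIntegrable t₀ u) :
    ∀ᵐ t, IntegrableOn (fun τ => K (t - τ) (u τ)) (Ioo t₀ t) := by
  filter_upwards [(hK.integrable_prod hu).prod_left_ae] with t ht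
  simp_rw [expKernel_sub_apply] at ht
  rw [integrable_indicator_iff measurableSet_Ioo] at ht
  have := ht.smul (Real.exp t)
  refine this.congr (Eventually.of_forall fun τ => ?_)
  simp [smul_smul, ← Real.exp_add]

theorem expIntegrable_volterra (hK : IsConvKernel K) {t₀ : ℝ} {u : ℝ → X}
    (hu : ExpIntegrable t₀ u) : ExpIntegrable t₀ (volterra K t₀ u) := by
  have := (hK.integrable_prod hu).integral_prod_right
  simp_rw [integral_expKernel] at this
  exact this.integrableOn

theorem volterra_add (hK : IsConvKernel K) {t₀ : ℝ} {u v : ℝ → X} (hu : ExpIntegrable t₀ u)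
    (hv : ExpIntegrable t₀ v) :
    ∀ᵐ t, volterra K t₀ (fun τ => u τ + v τ) t = volterra K t₀ u t + volterra K t₀ v t := by
  filter_upwards [hK.ae_integrableOn hu, hK.ae_integrableOn hv] with t h1 h2
  simp only [volterra, map_add]
  exact integral_add h1 h2

theorem volterra_sub (hK : IsConvKernel K) {t₀ : ℝ} {u v : ℝ → X} (hu : ExpIntegrable t₀ u)
    (hv : ExpIntegrable t₀ v) :
    ∀ᵐ t, volterra K t₀ (fun τ => u τ - v τ) t = volterra K t₀ u t - volterra K t₀ v t := by
  filter_upwards [hK.ae_integrableOn hu, hK.ae_integrableOn hv] with t h1 h2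
  simp only [volterra, map_sub]
  exact integral_sub h1 h2

/-- The composition of two Volterra convolutions is the Volterra convolution with the convolved
kernel. -/
theorem volterra_volterra [CompleteSpace X] (hK : IsConvKernel K) (hL : IsConvKernel L) {t₀ : ℝ}
    {u : ℝ → X} (hu : ExpIntegrable t₀ u) :
    ∀ᵐ t, volterra K t₀ (volterra L t₀ u) t =
      ∫ ρ in Ioo t₀ t, volterra K 0 (fun σ => L σ (u ρ)) (t - ρ) := by
  obtain ⟨κ, hκ, hbκ⟩ := hK.exists_bound_expKernel
  obtain ⟨l, hl, hbl⟩ := hL.exists_bound_expKernel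
  filter_upwards [ae_integral_clm_comp_eq hK.aestronglyMeasurable_expKernel hκ hbκ
    hL.aestronglyMeasurable_expKernel hl hbl hu.integrable_expFun] with t ht
  simp_rw [integral_expKernel_eq_expFun L, integral_expKernel K] at ht
  have hinner : ∀ ρ, ∫ σ, expKernel K (t - ρ - σ) (expKernel L σ (expFun t₀ u ρ)) =
      (Ioo t₀ t).indicator
        (fun ρ => Real.exp (-t) • volterra K 0 (fun σ => L σ (u ρ)) (t - ρ)) ρ := by
    intro ρ
    -- For fixed ρ the inner integral is again a weighted Volterra integral, now based at 0, of the
    -- orbit σ ↦ L σ (u ρ).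
    have hc : ∀ σ, expKernel L σ (expFun t₀ u ρ) = expFun 0 (fun σ => L σ (expFun t₀ u ρ)) σ := by
      intro σ
      by_cases h : 0 < σ
      · simp [expKernel, expFun, h]
      · simp [expKernel, expFun, h]
    simp_rw [hc]
    rw [integral_expKernel]
    by_cases h1 : t₀ < ρ
    · by_cases h2 : ρ < t
      · rw [indicator_of_mem (show ρ ∈ Ioo t₀ t from ⟨h1, h2⟩)]
        simp only [expFun, indicator_of_mem (show ρ ∈ Ioi t₀ from h1), volterra,
          ContinuousLinearMap.map_smul_of_tower]
        rw [integral_smul, smul_smul, ← Real.exp_add]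
        congr 2
        ring
      · rw [indicator_of_notMem (show ρ ∉ Ioo t₀ t from fun h => h2 h.2), volterra_of_le,
          smul_zero]
        linarith
    · rw [indicator_of_notMem (show ρ ∉ Ioo t₀ t from fun h => h1 h.1)]
      simp [expFun, h1, volterra]
  simp_rw [hinner] at ht
  rw [integral_indicator measurableSet_Ioo, integral_smul] at ht
  exact smul_right_injective X (Real.exp_pos _).ne' ht

end IsConvKernel

theorem volterra_congr_ae {K : ℝ → X →L[ℂ] X} {t₀ : ℝ} {u v : ℝ → X}
    (h : u =ᵐ[volume.restrict (Ioi t₀)] v) : volterra K t₀ u = volterra K t₀ v := by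
  ext t
  refine integral_congr_ae ?_
  filter_upwards [ae_restrict_of_ae_restrict_of_subset Ioo_subset_Ioi_self h] with τ hτ
  rw [hτ]

end Volterra

/-! ### Fractional kernels and the index law. -/

section PowerKernels

variable {X : Type*} [NormedAddCommGroup X] [NormedSpace ℂ X]

/-- Euler's beta integral on `(0, r)`. -/
theorem integral_Ioo_rpow_mul_rpow {a b r : ℝ} (ha : 0 < a) (hb : 0 < b) (hr : 0 < r) :
    ∫ σ in Ioo 0 r, (r - σ) ^ (a - 1) * σ ^ (b - 1) =
      r ^ (a + b - 1) * (Real.Gamma a * Real.Gamma b / Real.Gamma (a + b)) := by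
  have h := Complex.betaIntegral_scaled (b : ℂ) (a : ℂ) hr
  rw [Complex.betaIntegral_eq_Gamma_mul_div _ _ (by simpa using hb) (by simpa using ha),
    intervalIntegral.integral_of_le hr.le, ← integral_Ioc_eq_integral_Ioo] at *
  apply Complex.ofReal_injective
  rw [← integral_complex_ofReal]
  have e : ∀ σ ∈ Ioc 0 r, (((r - σ) ^ (a - 1) * σ ^ (b - 1) : ℝ) : ℂ) =
      (σ : ℂ) ^ ((b : ℂ) - 1) * ((r : ℂ) - σ) ^ ((a : ℂ) - 1) := by
    intro σ hσ
    rw [Complex.ofReal_mul, Complex.ofReal_cpow (sub_nonneg.2 hσ.2), Complex.ofReal_cpow hσ.1.le,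
      mul_comm]
    push_cast
    rfl
  rw [setIntegral_congr_fun measurableSet_Ioc e, h, Complex.ofReal_mul, Complex.ofReal_cpow hr.le,
    Complex.ofReal_div, Complex.ofReal_mul, ← Complex.Gamma_ofReal, ← Complex.Gamma_ofReal,
    ← Complex.Gamma_ofReal]
  push_cast
  rw [add_comm (b : ℂ), mul_comm (Complex.Gamma b)]

/-- The kernel `r^{σ-1} / Γ(σ) S(r)` of the fractional parabolic integral of order `σ`. -/
noncomputable def powKernel (S : ℝ → X →L[ℂ] X) (σ r : ℝ) : X →L[ℂ] X :=
  (r ^ (σ - 1) / Real.Gamma σ) • S r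

theorem powKernel_apply (S : ℝ → X →L[ℂ] X) (σ r : ℝ) (x : X) :
    powKernel S σ r x = (r ^ (σ - 1) / Real.Gamma σ) • S r x := rfl

theorem powKernel_one (S : ℝ → X →L[ℂ] X) : powKernel S 1 = S := by
  ext r x
  simp [powKernel_apply]

theorem fracInt_eq_volterra (S : ℝ → X →L[ℂ] X) (t₀ : ℝ) {σ : ℝ} (hσ : σ ≠ 0) (u : ℝ → X) :
    fracInt S t₀ σ u = volterra (powKernel S σ) t₀ u := by
  ext t
  rw [fracInt, if_neg hσ, volterra, ← integral_smul]
  refine integral_congr_ae (Eventually.of_forall fun τ => ?_)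
  simp only [fracIntegrand, powKernel_apply, smul_smul]
  congr 1
  ring

variable {S : ℝ → X →L[ℂ] X}

/-- Boundedness of S leaves the majorant M r^{σ-1} / Γ(σ), whose e^{-r}-weighted integral is Euler's
Gamma integral. -/
theorem isConvKernel_powKernel (hS : IsMeasurableSemigroup S) (hb : IsUniformlyBounded S) {σ : ℝ}
    (hσ : 0 < σ) : IsConvKernel (powKernel S σ) := by
  obtain ⟨M, hM⟩ := hb
  constructor
  · intro x
    have h1 : AEStronglyMeasurable (fun r => S r x) (volume.restrict (Ioi 0)) :=
      (hS.stronglyMeasurable x).mono_measure (Measure.restrict_mono Ioi_subset_Ici_self le_rfl)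
    have h2 : Measurable fun r : ℝ => r ^ (σ - 1) / Real.Gamma σ := by fun_prop
    exact h2.aestronglyMeasurable.smul h1
  · refine ⟨fun r => r ^ (σ - 1) / Real.Gamma σ * M, ?_, fun r hr => ?_⟩
    · refine ((Real.GammaIntegral_convergent hσ).mul_const (M / Real.Gamma σ)).congr
        (Eventually.of_forall fun r => ?_)
      simp only
      ring
    · have h0 : 0 ≤ r ^ (σ - 1) / Real.Gamma σ :=
        div_nonneg (Real.rpow_nonneg hr.le _) (Real.Gamma_pos_of_pos hσ).le
      rw [powKernel, norm_smul, Real.norm_of_nonneg h0]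
      exact mul_le_mul_of_nonneg_left (hM r hr.le) h0

theorem isConvKernel_semigroup (hS : IsMeasurableSemigroup S) (hb : IsUniformlyBounded S) :
    IsConvKernel S := by
  simpa [powKernel_one] using isConvKernel_powKernel hS hb one_pos

/-- The kernel of integration, that is, the identity operator. -/
noncomputable def idKernel (X : Type*) [NormedAddCommGroup X] [NormedSpace ℂ X] :
    ℝ → X →L[ℂ] X :=
  fun _ => ContinuousLinearMap.id ℂ X

theorem volterra_idKernel (t₀ : ℝ) (u : ℝ → X) (t : ℝ) :
    volterra (idKernel X) t₀ u t = ∫ τ in Ioo t₀ t, u τ := rfl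

theorem isConvKernel_idKernel : IsConvKernel (idKernel X) := by
  refine isConvKernel_semigroup ⟨rfl, fun _ _ _ _ => rfl, fun x => ?_, fun T => ⟨1, fun t _ => ?_⟩⟩
    ⟨1, fun t _ => ?_⟩
  · exact aestronglyMeasurable_const
  · exact ContinuousLinearMap.norm_id_le
  · exact ContinuousLinearMap.norm_id_le

/-- The semigroup law merges S(t - τ) S(τ - t₀) into S(t - t₀), independent of τ, leaving a scalar
beta integral. -/
theorem volterra_powKernel_powKernel_apply [CompleteSpace X] (hS : IsMeasurableSemigroup S)
    {a b : ℝ} (ha : 0 < a) (hb : 0 < b) {t₀ t : ℝ} (ht : t₀ < t) (c : X) :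
    volterra (powKernel S a) t₀ (fun τ => powKernel S b (τ - t₀) c) t =
      powKernel S (a + b) (t - t₀) c := by
  have e : ∀ τ ∈ Ioo t₀ t, powKernel S a (t - τ) (powKernel S b (τ - t₀) c) =
      ((fun σ => ((t - t₀ - σ) ^ (a - 1) * σ ^ (b - 1))) (τ - t₀)) •
        ((Real.Gamma a * Real.Gamma b)⁻¹ • S (t - t₀) c) := by
    intro τ hτ
    have : S (t - t₀) c = S (t - τ) (S (τ - t₀) c) := by
      have h := hS.map_add (t - τ) (τ - t₀) (sub_nonneg.2 hτ.2.le) (sub_nonneg.2 hτ.1.le)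
      rw [show t - t₀ = t - τ + (τ - t₀) by ring, h]
      rfl
    rw [this]
    simp only [powKernel_apply, ContinuousLinearMap.map_smul_of_tower, smul_smul]
    congr 1
    rw [show t - t₀ - (τ - t₀) = t - τ by ring]
    field_simp
  rw [volterra, setIntegral_congr_fun measurableSet_Ioo e, integral_smul_const]
  have hsh : ∫ τ in Ioo t₀ t, (fun σ => ((t - t₀ - σ) ^ (a - 1) * σ ^ (b - 1))) (τ - t₀) =
      ∫ σ in Ioo 0 (t - t₀), (t - t₀ - σ) ^ (a - 1) * σ ^ (b - 1) := by
    rw [← integral_Ioc_eq_integral_Ioo, ← integral_Ioc_eq_integral_Ioo,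
      ← intervalIntegral.integral_of_le ht.le, ← intervalIntegral.integral_of_le (by linarith),
      intervalIntegral.integral_comp_sub_right
        (fun σ => (t - t₀ - σ) ^ (a - 1) * σ ^ (b - 1)), sub_self]
  have hr : 0 < t - t₀ := sub_pos.2 ht
  have h1 := (Real.Gamma_pos_of_pos ha).ne'
  have h2 := (Real.Gamma_pos_of_pos hb).ne'
  have h3 := (Real.Gamma_pos_of_pos (add_pos ha hb)).ne'
  rw [hsh, integral_Ioo_rpow_mul_rpow ha hb hr, powKernel_apply, smul_smul]
  congr 1
  field_simp

/-- The index law for fractional parabolic integrals. -/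
theorem volterra_powKernel_volterra_powKernel [CompleteSpace X] (hS : IsMeasurableSemigroup S)
    (hbd : IsUniformlyBounded S) {a b : ℝ} (ha : 0 < a) (hb : 0 < b) {t₀ : ℝ} {u : ℝ → X}
    (hu : ExpIntegrable t₀ u) :
    ∀ᵐ t, volterra (powKernel S a) t₀ (volterra (powKernel S b) t₀ u) t =
      volterra (powKernel S (a + b)) t₀ u t := by
  filter_upwards [(isConvKernel_powKernel hS hbd ha).volterra_volterra
    (isConvKernel_powKernel hS hbd hb) hu] with t ht
  rw [ht, volterra]
  refine setIntegral_congr_fun measurableSet_Ioo fun ρ hρ => ?_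
  simpa using volterra_powKernel_powKernel_apply hS ha hb (sub_pos.2 hρ.2) (u ρ)

/-- Integration commutes with convolution with the semigroup. -/
theorem volterra_semigroup_idKernel [CompleteSpace X] (hS : IsMeasurableSemigroup S)
    (hbd : IsUniformlyBounded S) {t₀ : ℝ} {u : ℝ → X} (hu : ExpIntegrable t₀ u) :
    ∀ᵐ t, volterra S t₀ (volterra (idKernel X) t₀ u) t =
      volterra (idKernel X) t₀ (volterra S t₀ u) t := by
  have hK := isConvKernel_semigroup hS hbd
  filter_upwards [hK.volterra_volterra isConvKernel_idKernel hu,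
    isConvKernel_idKernel.volterra_volterra hK hu] with t h1 h2
  rw [h1, h2]
  refine setIntegral_congr_fun measurableSet_Ioo fun ρ hρ => ?_
  have hr : 0 ≤ t - ρ := sub_nonneg.2 hρ.2.le
  simp only [volterra, idKernel, ContinuousLinearMap.id_apply]
  rw [← integral_Ioc_eq_integral_Ioo, ← integral_Ioc_eq_integral_Ioo,
    ← intervalIntegral.integral_of_le hr, ← intervalIntegral.integral_of_le hr,
    intervalIntegral.integral_comp_sub_left (fun σ => S σ (u ρ)), sub_self, sub_zero]

theorem volterra_semigroup_const [CompleteSpace X] {t₀ t : ℝ} (ht : t₀ ≤ t) (c : X) :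
    volterra S t₀ (fun _ => c) t = ∫ σ in Ioo t₀ t, S (σ - t₀) c := by
  rw [volterra, ← integral_Ioc_eq_integral_Ioo, ← integral_Ioc_eq_integral_Ioo,
    ← intervalIntegral.integral_of_le ht, ← intervalIntegral.integral_of_le ht,
    intervalIntegral.integral_comp_sub_left (fun σ => S σ c),
    intervalIntegral.integral_comp_sub_right (fun σ => S σ c), sub_self, sub_self]

end PowerKernels

/-! ### Primitives and their injectivity. -/

section Primitive

variable {X : Type*} [NormedAddCommGroup X] [NormedSpace ℂ X]

theorem ExpIntegrable.locallyIntegrable_indicator {t₀ : ℝ} {u : ℝ → X}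
    (hu : ExpIntegrable t₀ u) : LocallyIntegrable ((Ioi t₀).indicator u) := by
  rw [locallyIntegrable_iff]
  intro k hk
  have h := (hu.integrable_expFun.integrableOn (s := k)).continuousOn_smul
    Real.continuous_exp.continuousOn hk
  refine h.congr (Eventually.of_forall fun t => ?_)
  by_cases ht : t₀ < t
  · simp [expFun, ht, smul_smul, ← Real.exp_add]
  · simp [expFun, ht]

theorem volterra_idKernel_eq_intervalIntegral {t₀ t : ℝ} (ht : t₀ ≤ t) (u : ℝ → X) :
    volterra (idKernel X) t₀ u t = ∫ τ in t₀..t, (Ioi t₀).indicator u τ := by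
  rw [volterra_idKernel, intervalIntegral.integral_of_le ht, ← integral_Ioc_eq_integral_Ioo]
  refine setIntegral_congr_fun measurableSet_Ioc fun τ hτ => ?_
  rw [indicator_of_mem (show τ ∈ Ioi t₀ from hτ.1)]

theorem ExpIntegrable.continuousOn_primitive {t₀ : ℝ} {u : ℝ → X} (hu : ExpIntegrable t₀ u) :
    ContinuousOn (volterra (idKernel X) t₀ u) (Ici t₀) := by
  have h : Continuous fun t => ∫ τ in t₀..t, (Ioi t₀).indicator u τ :=
    intervalIntegral.continuous_primitive
      (fun a b => intervalIntegrable_iff.mpr <|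
        (LocallyIntegrable.integrableOn_isCompact hu.locallyIntegrable_indicator
          isCompact_uIcc).mono_set uIoc_subset_uIcc) t₀
  exact h.continuousOn.congr fun t ht => volterra_idKernel_eq_intervalIntegral ht u

/-- A function whose primitive vanishes almost everywhere vanishes almost everywhere. -/
theorem ExpIntegrable.ae_eq_zero_of_primitive [CompleteSpace X] {t₀ : ℝ} {u : ℝ → X}
    (hu : ExpIntegrable t₀ u)
    (h : ∀ᵐ t ∂volume.restrict (Ioi t₀), volterra (idKernel X) t₀ u t = 0) :
    ∀ᵐ t ∂volume.restrict (Ioi t₀), u t = 0 := by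
  have h0 : EqOn (volterra (idKernel X) t₀ u) (fun _ => 0) (Ioi t₀) :=
    Measure.eqOn_open_of_ae_eq h isOpen_Ioi
      (hu.continuousOn_primitive.mono Ioi_subset_Ici_self) continuousOn_const
  rw [ae_restrict_iff' measurableSet_Ioi]
  filter_upwards [LocallyIntegrable.ae_hasDerivAt_integral hu.locallyIntegrable_indicator]
    with t ht htt
  have h1 := ht t₀
  rw [indicator_of_mem htt] at h1
  have h2 : (fun t => ∫ τ in t₀..t, (Ioi t₀).indicator u τ) =ᶠ[𝓝 t] fun _ => 0 := by
    filter_upwards [isOpen_Ioi.mem_nhds htt] with r hr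
    rw [← volterra_idKernel_eq_intervalIntegral (le_of_lt hr)]
    exact h0 hr
  exact h1.unique ((hasDerivAt_const t (0 : X)).congr_of_eventuallyEq h2)

end Primitive

/-! ### The resolvent and the semigroup on D(A). -/

section Generator

variable {X : Type*} [NormedAddCommGroup X] [NormedSpace ℂ X]

theorem opApply_of_mem {A : X →ₗ.[ℂ] X} {x : X} (h : x ∈ A.domain) : opApply A x = A ⟨x, h⟩ :=
  dif_pos h

theorem opApply_add {A : X →ₗ.[ℂ] X} {x y : X} (hx : x ∈ A.domain) (hy : y ∈ A.domain) :
    opApply A (x + y) = opApply A x + opApply A y := by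
  rw [opApply_of_mem hx, opApply_of_mem hy, opApply_of_mem (A.domain.add_mem hx hy), ← A.map_add]
  rfl

theorem opApply_smul {A : X →ₗ.[ℂ] X} (c : ℂ) {x : X} (hx : x ∈ A.domain) :
    opApply A (c • x) = c • opApply A x := by
  rw [opApply_of_mem hx, opApply_of_mem (A.domain.smul_mem c hx), ← A.map_smul]
  rfl

theorem opApply_zero (A : X →ₗ.[ℂ] X) : opApply A 0 = 0 := by
  simpa using opApply_smul (A := A) 0 A.domain.zero_mem

theorem opApply_nsmul {A : X →ₗ.[ℂ] X} (c : ℕ) {x : X} (hx : x ∈ A.domain) :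
    opApply A (c • x) = c • opApply A x := by
  simpa only [Nat.cast_smul_eq_nsmul] using opApply_smul (A := A) (c : ℂ) hx

theorem opApply_sum {A : X →ₗ.[ℂ] X} {ι : Type*} (s : Finset ι) {f : ι → X}
    (hf : ∀ i ∈ s, f i ∈ A.domain) :
    opApply A (∑ i ∈ s, f i) = ∑ i ∈ s, opApply A (f i) := by
  classical
  induction s using Finset.induction_on with
  | empty => simp [opApply_zero]
  | insert a s ha ih =>
    rw [Finset.sum_insert ha, Finset.sum_insert ha,
      opApply_add (hf a (Finset.mem_insert_self a s))
        (A.domain.sum_mem fun i hi => hf i (Finset.mem_insert_of_mem hi)),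
      ih fun i hi => hf i (Finset.mem_insert_of_mem hi)]

/-- `R = (z + A)⁻¹` for a positive real number `z`, and `R` commutes with the semigroup. -/
structure IsSemigroupResolvent (S : ℝ → X →L[ℂ] X) (A : X →ₗ.[ℂ] X) (z : ℝ) (R : X →L[ℂ] X) :
    Prop where
  mem_domain : ∀ x, R x ∈ A.domain
  add_opApply : ∀ x, z • R x + opApply A (R x) = x
  apply_add : ∀ x ∈ A.domain, R (z • x + opApply A x) = x
  comm : ∀ t, 0 ≤ t → ∀ x, R (S t x) = S t (R x)
  exp_smul : ∀ h, 0 ≤ h → ∀ x,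
    Real.exp (-z * h) • S h (R x) = R x - ∫ t in 0..h, Real.exp (-z * t) • S t x

variable {S : ℝ → X →L[ℂ] X} {A : X →ₗ.[ℂ] X}

theorem integrableOn_exp_smul_semigroup (hS : IsMeasurableSemigroup S)
    (hb : IsUniformlyBounded S) {z : ℝ} (hz : 0 < z) (x : X) :
    IntegrableOn (fun t => Real.exp (-z * t) • S t x) (Ioi 0) := by
  obtain ⟨M, hM⟩ := hb
  refine ((exp_neg_integrableOn_Ioi 0 hz).mul_const (M * ‖x‖)).mono' ?_ ?_
  · exact (by fun_prop : Continuous fun t : ℝ => Real.exp (-z * t)).aestronglyMeasurable.smul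
      ((hS.stronglyMeasurable x).mono_measure (Measure.restrict_mono Ioi_subset_Ici_self le_rfl))
  · filter_upwards [ae_restrict_mem measurableSet_Ioi] with t ht
    rw [norm_smul, Real.norm_of_nonneg (Real.exp_pos _).le]
    gcongr
    exact (S t).le_of_opNorm_le (hM t (le_of_lt ht)) x

theorem laplace_ofReal (S : ℝ → X →L[ℂ] X) (z : ℝ) (x : X) :
    laplace S z x = ∫ t in Ioi (0 : ℝ), Real.exp (-z * t) • S t x := by
  refine integral_congr_ae (Eventually.of_forall fun t => ?_)
  simp only
  rw [← Complex.coe_smul]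
  push_cast
  rfl

/-- R is the Laplace transform at a single real point. Commutation with S is the semigroup law under
the integral, and translating the integral by h leaves its tail over (h, ∞), which gives the
`exp_smul` identity. -/
theorem exists_isSemigroupResolvent [CompleteSpace X] (hS : IsMeasurableSemigroup S)
    (hb : IsUniformlyBounded S) (hA : IsNegGenerator S A) :
    ∃ (z : ℝ) (R : X →L[ℂ] X), IsSemigroupResolvent S A z R := by
  obtain ⟨w, hw⟩ := hA
  -- Above w so that the generator hypothesis applies, and positive so that e^{-zt} S(t) x is
  -- integrable for bounded S.
  set z : ℝ := max w 0 + 1 with hz_def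
  have hz : 0 < z := by positivity
  obtain ⟨h1, h2⟩ := hw z (by
    rw [Complex.ofReal_re]
    exact (le_max_left w 0).trans_lt (lt_add_one _))
  have hint := fun x => integrableOn_exp_smul_semigroup hS hb hz x
  obtain ⟨M, hM⟩ := id hb
  let R₀ : X →ₗ[ℂ] X :=
    { toFun := fun x => ∫ t in Ioi (0 : ℝ), Real.exp (-z * t) • S t x
      map_add' := fun x y => by
        simp only [map_add, smul_add]
        exact integral_add (hint x) (hint y)
      map_smul' := fun c x => by
        simp only [map_smul, RingHom.id_apply]
        rw [← integral_smul]
        simp_rw [smul_comm c] }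
  let R : X →L[ℂ] X := R₀.mkContinuous (∫ t in Ioi (0 : ℝ), Real.exp (-z * t) * M) fun x => by
    rw [← integral_mul_const]
    refine norm_integral_le_of_norm_le
      (((exp_neg_integrableOn_Ioi 0 hz).mul_const M).mul_const ‖x‖) ?_
    filter_upwards [ae_restrict_mem measurableSet_Ioi] with t ht
    rw [norm_smul, Real.norm_of_nonneg (Real.exp_pos _).le, mul_assoc]
    gcongr
    exact (S t).le_of_opNorm_le (hM t (le_of_lt ht)) x
  have hR : ∀ x, R x = ∫ t in Ioi (0 : ℝ), Real.exp (-z * t) • S t x := fun x => rfl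
  have hRl : ∀ x, R x = laplace S z x := fun x => (laplace_ofReal S z x).symm
  have hshift : ∀ h, 0 ≤ h → ∀ x,
      S h (R x) = ∫ t in Ioi (0 : ℝ), Real.exp (-z * t) • S (h + t) x := by
    intro h hh x
    rw [hR, ← (S h).integral_comp_comm (hint x)]
    refine setIntegral_congr_fun measurableSet_Ioi fun t ht => ?_
    rw [(S h).map_smul_of_tower, hS.map_add h t hh (le_of_lt ht)]
    rfl
  refine ⟨z, R, ⟨fun x => ?_, fun x => ?_, fun x hx => ?_, fun t ht x => ?_, fun h hh x => ?_⟩⟩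
  · rw [hRl]
    exact (h1 x).1
  · obtain ⟨hm, he⟩ := h1 x
    rw [hRl, opApply_of_mem hm, ← Complex.coe_smul]
    exact he
  · rw [hRl, opApply_of_mem hx, ← Complex.coe_smul]
    exact h2 ⟨x, hx⟩
  · rw [hshift t ht, hR]
    refine setIntegral_congr_fun measurableSet_Ioi fun r hr => ?_
    rw [add_comm t r, hS.map_add r t (le_of_lt hr) ht]
    rfl
  · rw [hshift h hh, hR]
    have e1 : Real.exp (-z * h) • ∫ t in Ioi (0 : ℝ), Real.exp (-z * t) • S (h + t) x =
        ∫ t in Ioi h, Real.exp (-z * t) • S t x := by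
      have hs := (measurePreserving_add_left volume h).setIntegral_preimage_emb
        (measurableEmbedding_addLeft h) (fun t => Real.exp (-z * t) • S t x) (Ioi h)
      rw [show (fun t => h + t) ⁻¹' Ioi h = Ioi 0 by ext; simp] at hs
      rw [← integral_smul, ← hs]
      refine setIntegral_congr_fun measurableSet_Ioi fun t _ => ?_
      rw [smul_smul, ← Real.exp_add]
      congr 2
      ring
    rw [e1, eq_sub_iff_add_eq, add_comm]
    exact intervalIntegral.integral_interval_add_Ioi (hint x)
      ((hint x).mono_set (Ioi_subset_Ioi hh))

namespace IsSemigroupResolvent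

variable {z : ℝ} {R : X →L[ℂ] X}

theorem opApply_apply (hR : IsSemigroupResolvent S A z R) (x : X) :
    opApply A (R x) = x - z • R x :=
  eq_sub_of_add_eq' (hR.add_opApply x)

theorem injective (hR : IsSemigroupResolvent S A z R) : Function.Injective R := by
  intro x y h
  rw [← hR.add_opApply x, ← hR.add_opApply y, h]

theorem opApply_comm (hR : IsSemigroupResolvent S A z R) {x : X} (hx : x ∈ A.domain) :
    opApply A (R x) = R (opApply A x) := by
  rw [hR.opApply_apply]
  nth_rw 1 [← hR.apply_add x hx]
  rw [map_add, R.map_smul_of_tower, add_sub_cancel_left]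

theorem semigroup_mem_domain (hR : IsSemigroupResolvent S A z R) {t : ℝ} (ht : 0 ≤ t) {x : X}
    (hx : x ∈ A.domain) : S t x ∈ A.domain := by
  rw [← hR.apply_add x hx, ← hR.comm t ht]
  exact hR.mem_domain _

/-- On the range of R one has A = R⁻¹ - z, and S commutes with R; injectivity of R removes the extra
R applied to both sides. -/
theorem opApply_semigroup (hR : IsSemigroupResolvent S A z R) {t : ℝ} (ht : 0 ≤ t) {x : X}
    (hx : x ∈ A.domain) : opApply A (S t x) = S t (opApply A x) := by
  apply hR.injective
  rw [← hR.opApply_comm (hR.semigroup_mem_domain ht hx), hR.comm t ht, hR.comm t ht,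
    ← hR.opApply_comm hx]
  have h := hR.opApply_apply (S t x)
  rw [hR.comm t ht] at h
  rw [h, hR.opApply_apply, map_sub, (S t).map_smul_of_tower]

/-- A form of closedness: `A x = y` if `x = R (z x + y)`. -/
theorem mem_domain_of_eq (hR : IsSemigroupResolvent S A z R) {x y : X} (h : x = R (z • x + y)) :
    x ∈ A.domain ∧ opApply A x = y := by
  refine ⟨h ▸ hR.mem_domain _, ?_⟩
  have := hR.opApply_apply (z • x + y)
  rw [← h] at this
  rw [this, add_sub_cancel_left]

theorem intervalIntegrable_exp_smul (hS : IsMeasurableSemigroup S) (hb : IsUniformlyBounded S)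
    (z : ℝ) (x : X) {a h : ℝ} (ha : 0 ≤ a) (hh : 0 ≤ h) :
    IntervalIntegrable (fun r => Real.exp (-z * r) • S r x) volume a h := by
  have h1 := integrableOn_exp_smul_semigroup hS hb one_pos x
  have h2 : IntervalIntegrable (fun r => Real.exp (-1 * r) • S r x) volume a h := by
    rw [intervalIntegrable_iff]
    exact h1.mono_set fun t ht => lt_of_le_of_lt (le_min ha hh) ht.1
  have h3 := h2.continuousOn_smul
    (by fun_prop : Continuous fun r : ℝ => Real.exp ((1 - z) * r)).continuousOn
  refine h3.congr (fun t _ => ?_)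
  simp only [smul_smul, ← Real.exp_add]
  congr 2
  ring

theorem intervalIntegrable_semigroup (hS : IsMeasurableSemigroup S) (hb : IsUniformlyBounded S)
    (x : X) {a h : ℝ} (ha : 0 ≤ a) (hh : 0 ≤ h) :
    IntervalIntegrable (fun r => S r x) volume a h := by
  simpa using intervalIntegrable_exp_smul hS hb 0 x ha hh

theorem semigroup_apply_apply (hR : IsSemigroupResolvent S A z R) {h : ℝ} (hh : 0 ≤ h) (x : X) :
    S h (R x) = Real.exp (z * h) • (R x - ∫ t in 0..h, Real.exp (-z * t) • S t x) := by
  rw [← hR.exp_smul h hh, smul_smul, ← Real.exp_add, neg_mul, add_neg_cancel, Real.exp_zero,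
    one_smul]

theorem continuousOn_primitive_exp_smul (hS : IsMeasurableSemigroup S)
    (hb : IsUniformlyBounded S) (z : ℝ) (x : X) :
    ContinuousOn (fun h => ∫ t in 0..h, Real.exp (-z * t) • S t x) (Ici 0) := by
  intro t ht
  have ht1 : 0 ≤ t + 1 := by linarith [mem_Ici.1 ht]
  have h0 : IntegrableOn (fun t => Real.exp (-z * t) • S t x) (uIcc 0 (t + 1)) := by
    rw [uIcc_of_le ht1, integrableOn_Icc_iff_integrableOn_Ioc]
    exact (intervalIntegrable_iff_integrableOn_Ioc_of_le ht1).1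
      (intervalIntegrable_exp_smul hS hb z x le_rfl ht1)
  have h1 := intervalIntegral.continuousOn_primitive_interval h0
  rw [uIcc_of_le ht1] at h1
  refine (h1 t ⟨ht, by linarith⟩).mono_of_mem_nhdsWithin ?_
  rw [← Ici_inter_Iic]
  exact inter_mem self_mem_nhdsWithin (mem_nhdsWithin_of_mem_nhds (Iic_mem_nhds (by linarith)))

/-- An element of D(A) is R y for some y, and S(h) R y is e^{zh} times a constant minus a primitive
in h, hence continuous up to h = 0. -/
theorem continuousOn_semigroup (hR : IsSemigroupResolvent S A z R)
    (hS : IsMeasurableSemigroup S) (hb : IsUniformlyBounded S) {x : X} (hx : x ∈ A.domain) :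
    ContinuousOn (fun t => S t x) (Ici 0) := by
  rw [← hR.apply_add x hx]
  set y := z • x + opApply A x
  have h : ContinuousOn (fun h => Real.exp (z * h) •
      (R y - ∫ t in 0..h, Real.exp (-z * t) • S t y)) (Ici 0) :=
    (by fun_prop : Continuous fun h : ℝ => Real.exp (z * h)).continuousOn.smul
      (continuousOn_const.sub (continuousOn_primitive_exp_smul hS hb z y))
  exact h.congr fun t ht => hR.semigroup_apply_apply ht y

/-- After applying R, the explicit formula for S(t) R x can be differentiated, because t ↦ S(t) x is
continuous for x ∈ D(A); the derivative is -S(t) A R x. Integrate and cancel R. -/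
theorem semigroup_apply (hR : IsSemigroupResolvent S A z R) [CompleteSpace X]
    (hS : IsMeasurableSemigroup S) (hb : IsUniformlyBounded S) {x : X} (hx : x ∈ A.domain)
    {h : ℝ} (hh : 0 ≤ h) :
    S h x = x - ∫ r in Ioo 0 h, S r (opApply A x) := by
  apply hR.injective
  have hint := intervalIntegrable_semigroup hS hb (opApply A x) le_rfl hh
  rw [← integral_Ioc_eq_integral_Ioo, ← intervalIntegral.integral_of_le hh, map_sub,
    ← R.intervalIntegral_comp_comm hint, hR.comm h hh]
  have hc := hR.continuousOn_semigroup hS hb hx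
  have hderiv : ∀ t ∈ Ioo 0 h, HasDerivAt (fun t => Real.exp (z * t) •
      (R x - ∫ t in 0..t, Real.exp (-z * t) • S t x)) (- S t (opApply A (R x))) t := by
    intro t ht
    have hexp : ContinuousOn (fun t => Real.exp (-z * t) • S t x) (Ioi 0) :=
      (by fun_prop : Continuous fun t : ℝ => Real.exp (-z * t)).continuousOn.smul
        (hc.mono Ioi_subset_Ici_self)
    have h1 : HasDerivAt (fun t => ∫ t in 0..t, Real.exp (-z * t) • S t x)
        (Real.exp (-z * t) • S t x) t :=
      intervalIntegral.integral_hasDerivAt_right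
        (intervalIntegrable_exp_smul hS hb z x le_rfl ht.1.le)
        (hexp.stronglyMeasurableAtFilter isOpen_Ioi t ht.1)
        (hexp.continuousAt (isOpen_Ioi.mem_nhds ht.1))
    have h2 : HasDerivAt (fun t : ℝ => Real.exp (z * t)) (Real.exp (z * t) * z) t := by
      simpa using ((hasDerivAt_id t).const_mul z).exp
    have h3 := h2.smul (h1.const_sub (R x))
    refine h3.congr_deriv ?_
    rw [← hR.exp_smul t ht.1.le, smul_neg, smul_smul, smul_smul, ← Real.exp_add,
      hR.opApply_apply, map_sub, (S t).map_smul_of_tower, mul_right_comm, ← Real.exp_add]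
    simp [← sub_eq_neg_add]
  have hcont : ContinuousOn (fun t => Real.exp (z * t) •
      (R x - ∫ t in 0..t, Real.exp (-z * t) • S t x)) (Icc 0 h) :=
    (by fun_prop : Continuous fun h : ℝ => Real.exp (z * h)).continuousOn.smul
      (continuousOn_const.sub ((continuousOn_primitive_exp_smul hS hb z x).mono
        Icc_subset_Ici_self))
  have hftc := intervalIntegral.integral_eq_sub_of_hasDerivAt_of_le hh hcont hderiv
    (intervalIntegrable_semigroup hS hb _ le_rfl hh).neg
  rw [← hR.semigroup_apply_apply hh, ← hR.semigroup_apply_apply le_rfl, hS.map_zero,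
    intervalIntegral.integral_neg, hR.opApply_comm hx,
    ContinuousLinearMap.id_apply] at hftc
  rw [eq_sub_iff_add_eq, ← eq_sub_iff_add_eq', ← neg_sub, ← hftc, neg_neg]
  refine intervalIntegral.integral_congr fun t ht => ?_
  rw [uIcc_of_le hh] at ht
  exact (hR.comm t ht.1 _)

end IsSemigroupResolvent

end Generator

/-! ### Weak derivatives as derivatives of primitives. -/

section WeakDerivative

variable {X : Type*} [NormedAddCommGroup X] [NormedSpace ℂ X]

theorem integrableOn_exp_neg (t₀ : ℝ) : IntegrableOn (fun t : ℝ => Real.exp (-t)) (Ioi t₀) := by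
  simpa using exp_neg_integrableOn_Ioi t₀ one_pos

/-- On (t₀, ∞) the measure e^{-t} dt is finite and at most e^{-t₀} dt, so L^p embeds in its L^p and
then in its L^1. -/
theorem ExpIntegrable.of_memLp {p : ℝ≥0∞} (hp : 1 ≤ p) {t₀ : ℝ} {u : ℝ → X}
    (hu : MemLp u p (volume.restrict (Ioi t₀))) : ExpIntegrable t₀ u := by
  set μ := volume.restrict (Ioi t₀)
  have hfin : IsFiniteMeasure (μ.withDensity fun t => ENNReal.ofReal (Real.exp (-t))) :=
    isFiniteMeasure_withDensity_ofReal (integrableOn_exp_neg t₀).hasFiniteIntegral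
  have hle : μ.withDensity (fun t => ENNReal.ofReal (Real.exp (-t))) ≤
      ENNReal.ofReal (Real.exp (-t₀)) • μ := by
    rw [← withDensity_const]
    refine withDensity_mono ?_
    filter_upwards [ae_restrict_mem measurableSet_Ioi] with t ht
    exact ENNReal.ofReal_le_ofReal (Real.exp_le_exp.2 (neg_le_neg (le_of_lt ht)))
  have h := (hu.of_measure_le_smul ENNReal.ofReal_ne_top hle).integrable hp
  rw [integrable_withDensity_iff_integrable_smul' (by fun_prop)
    (Eventually.of_forall fun _ => ENNReal.ofReal_lt_top)] at h
  refine h.congr (Eventually.of_forall fun t => ?_)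
  simp only
  rw [ENNReal.toReal_ofReal (Real.exp_pos _).le]

theorem ExpIntegrable.aestronglyMeasurable {t₀ : ℝ} {u : ℝ → X} (hu : ExpIntegrable t₀ u) :
    AEStronglyMeasurable u (volume.restrict (Ioi t₀)) := by
  have h := Real.continuous_exp.aestronglyMeasurable.smul (Integrable.aestronglyMeasurable hu)
  refine h.congr (Eventually.of_forall fun t => ?_)
  simp [smul_smul, ← Real.exp_add]

theorem ExpIntegrable.add {t₀ : ℝ} {u v : ℝ → X} (hu : ExpIntegrable t₀ u)
    (hv : ExpIntegrable t₀ v) : ExpIntegrable t₀ fun t => u t + v t := by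
  simp only [ExpIntegrable, smul_add]
  exact Integrable.add hu hv

theorem ExpIntegrable.sub {t₀ : ℝ} {u v : ℝ → X} (hu : ExpIntegrable t₀ u)
    (hv : ExpIntegrable t₀ v) : ExpIntegrable t₀ fun t => u t - v t := by
  simp only [ExpIntegrable, smul_sub]
  exact Integrable.sub hu hv

theorem ExpIntegrable.const (t₀ : ℝ) (c : X) : ExpIntegrable t₀ fun _ => c :=
  (integrableOn_exp_neg t₀).smul_const c

theorem ExpIntegrable.congr {t₀ : ℝ} {u v : ℝ → X} (hu : ExpIntegrable t₀ u)
    (h : u =ᵐ[volume.restrict (Ioi t₀)] v) : ExpIntegrable t₀ v :=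
  Integrable.congr hu (h.mono fun t ht => by simp only [ht])

theorem ExpIntegrable.clm_comp {t₀ : ℝ} {u : ℝ → X} (hu : ExpIntegrable t₀ u) (R : X →L[ℂ] X) :
    ExpIntegrable t₀ fun t => R (u t) := by
  refine (R.integrable_comp hu).congr (Eventually.of_forall fun t => ?_)
  exact R.map_smul_of_tower _ _

theorem ExpIntegrable.smul {t₀ : ℝ} {u : ℝ → X} (hu : ExpIntegrable t₀ u) (c : ℝ) :
    ExpIntegrable t₀ fun t => c • u t := by
  refine (Integrable.smul c hu).congr (Eventually.of_forall fun t => ?_)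
  exact smul_comm _ _ _

theorem ExpIntegrable.locallyIntegrableOn {t₀ : ℝ} {u : ℝ → X} (hu : ExpIntegrable t₀ u) :
    LocallyIntegrableOn u (Ioi t₀) := by
  refine (hu.locallyIntegrable_indicator.locallyIntegrableOn (Ioi t₀)).congr ?_
  filter_upwards [ae_restrict_mem measurableSet_Ioi] with t ht
  exact indicator_of_mem ht u

/-- Integration by parts for the primitive of a weighted integrable function against a test
function. -/
theorem ExpIntegrable.integral_deriv_smul_primitive [CompleteSpace X] {t₀ : ℝ} {v : ℝ → X}
    (hv : ExpIntegrable t₀ v) {φ : ℝ → ℝ} (hφ : ContDiff ℝ ∞ φ) (hc : HasCompactSupport φ) :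
    ∫ t in Ioi t₀, deriv φ t • volterra (idKernel X) t₀ v t = - ∫ t in Ioi t₀, φ t • v t := by
  set μ := volume.restrict (Ioi t₀)
  have hφ1 : ContDiff ℝ 1 φ := hφ.of_le (by exact_mod_cast le_top)
  have hφ' : Continuous (deriv φ) := hφ1.continuous_deriv le_rfl
  have hbd : Integrable (fun t => deriv φ t * Real.exp t) μ :=
    ((hφ'.mul Real.continuous_exp).integrable_of_hasCompactSupport hc.deriv.mul_right).restrict
  -- Fubini on the triangle τ < t: integrating φ' over (τ, ∞) yields -φ(τ).
  set F : ℝ → ℝ → X := fun t τ => (Ioi τ).indicator (fun t => deriv φ t • v τ) t with hF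
  have hFint : Integrable (Function.uncurry F) (μ.prod μ) := by
    refine (hbd.norm.mul_prod (Integrable.norm hv)).mono' ?_ ?_
    · have h1 : AEStronglyMeasurable (fun q : ℝ × ℝ => deriv φ q.1 • v q.2) (μ.prod μ) :=
        (hφ'.comp continuous_fst).aestronglyMeasurable.smul hv.aestronglyMeasurable.comp_snd
      have h2 : Function.uncurry F =
          {q : ℝ × ℝ | q.2 < q.1}.indicator fun q : ℝ × ℝ => deriv φ q.1 • v q.2 := by
        ext q
        rfl
      rw [h2]
      exact h1.indicator (measurableSet_lt measurable_snd measurable_fst)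
    · refine Eventually.of_forall fun q => ?_
      by_cases h : q.2 < q.1
      · have : Function.uncurry F q = deriv φ q.1 • v q.2 :=
          indicator_of_mem (show q.1 ∈ Ioi q.2 from h) fun t => deriv φ t • v q.2
        rw [this, norm_smul, norm_mul, norm_smul, Real.norm_of_nonneg (Real.exp_pos _).le,
          Real.norm_of_nonneg (Real.exp_pos _).le]
        -- On the triangle e^t e^{-τ} ≥ 1: the factor e^{-τ} makes v integrable, while e^t is
        -- harmless on the compact support of φ'.
        have h1 : 1 ≤ Real.exp q.1 * Real.exp (-q.2) := by
          rw [← Real.exp_add]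
          exact Real.one_le_exp (by linarith)
        calc ‖deriv φ q.1‖ * ‖v q.2‖ = 1 * (‖deriv φ q.1‖ * ‖v q.2‖) := (one_mul _).symm
          _ ≤ (Real.exp q.1 * Real.exp (-q.2)) * (‖deriv φ q.1‖ * ‖v q.2‖) := by gcongr
          _ = _ := by ring
      · have : Function.uncurry F q = 0 :=
          indicator_of_notMem (show q.1 ∉ Ioi q.2 from h) fun t => deriv φ t • v q.2
        rw [this, norm_zero]
        positivity
  have hsw := integral_integral_swap hFint
  have h1 : ∀ t, ∫ τ, F t τ ∂μ = deriv φ t • volterra (idKernel X) t₀ v t := by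
    intro t
    have : F t = (Iio t).indicator fun τ => deriv φ t • v τ := by
      ext τ
      rfl
    rw [this, integral_indicator measurableSet_Iio, Measure.restrict_restrict measurableSet_Iio,
      Iio_inter_Ioi, integral_smul, volterra_idKernel]
  have h2 : ∀ τ ∈ Ioi t₀, ∫ t, F t τ ∂μ = - (φ τ • v τ) := by
    intro τ hτ
    rw [hF, integral_indicator measurableSet_Ioi, Measure.restrict_restrict measurableSet_Ioi,
      Ioi_inter_Ioi, sup_of_le_left (le_of_lt hτ), integral_smul_const,
      hc.integral_Ioi_deriv_eq hφ1, neg_smul]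
  simp_rw [h1] at hsw
  rw [hsw, ← integral_neg]
  exact setIntegral_congr_fun measurableSet_Ioi h2

/-- A test function with vanishing integral is the derivative of a test function. -/
theorem exists_testFunction_deriv_eq {t₀ : ℝ} {θ : ℝ → ℝ} (hθ : ContDiff ℝ ∞ θ)
    (hc : HasCompactSupport θ) (hs : tsupport θ ⊆ Ioi t₀) (h0 : ∫ t, θ t = 0) :
    ∃ ψ : ℝ → ℝ, ContDiff ℝ ∞ ψ ∧ HasCompactSupport ψ ∧ tsupport ψ ⊆ Ioi t₀ ∧ deriv ψ = θ := by
  obtain ⟨a, b, ha, hab⟩ : ∃ a b, t₀ < a ∧ tsupport θ ⊆ Icc a b := by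
    rcases (tsupport θ).eq_empty_or_nonempty with he | hne
    · exact ⟨t₀ + 1, t₀ + 1, lt_add_one t₀, by simp [he]⟩
    · have hcomp : IsCompact (tsupport θ) := hc
      obtain ⟨a, ha, ha'⟩ := hcomp.exists_isLeast hne
      obtain ⟨b, -, hb'⟩ := hcomp.exists_isGreatest hne
      exact ⟨a, b, hs ha, fun x hx => ⟨ha' hx, hb' hx⟩⟩
  have hz : ∀ t, t ∉ Icc a b → θ t = 0 := fun t ht => image_eq_zero_of_notMem_tsupport
    fun h => ht (hab h)
  have hint : ∀ x y, IntervalIntegrable θ volume x y := fun x y =>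
    hθ.continuous.intervalIntegrable x y
  have hd : ∀ t, HasDerivAt (fun t => ∫ x in a..t, θ x) (θ t) t := fun t =>
    intervalIntegral.integral_hasDerivAt_right (hint a t)
      (hθ.continuous.stronglyMeasurableAtFilter _ _) hθ.continuous.continuousAt
  have hderiv : deriv (fun t => ∫ x in a..t, θ x) = θ := funext fun t => (hd t).deriv
  have hsupp : Function.support (fun t => ∫ x in a..t, θ x) ⊆ Icc a b := by
    intro t ht
    by_contra hcon
    apply ht
    rcases lt_or_ge t a with h | h
    · show ∫ x in a..t, θ x = 0
      rw [intervalIntegral.integral_symm, intervalIntegral.integral_of_le h.le,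
        integral_Ioc_eq_integral_Ioo, neg_eq_zero]
      exact setIntegral_eq_zero_of_forall_eq_zero fun x hx =>
        hz x fun hx' => not_lt.2 hx'.1 hx.2
    · have hb : b < t := not_le.1 fun hb => hcon ⟨h, hb⟩
      show ∫ x in a..t, θ x = 0
      rw [intervalIntegral.integral_of_le h, ← integral_Icc_eq_integral_Ioc, ← h0]
      refine setIntegral_eq_integral_of_forall_compl_eq_zero fun x hx => hz x fun hx' => hx ?_
      exact ⟨hx'.1, hx'.2.trans hb.le⟩
  have hts : tsupport (fun t => ∫ x in a..t, θ x) ⊆ Icc a b :=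
    closure_minimal hsupp isClosed_Icc
  refine ⟨fun t => ∫ x in a..t, θ x, ?_, ?_, ?_, hderiv⟩
  · rw [contDiff_infty_iff_deriv, hderiv]
    exact ⟨fun t => (hd t).differentiableAt, hθ⟩
  · exact isCompact_Icc.of_isClosed_subset (isClosed_tsupport _) hts
  · exact hts.trans fun x hx => ha.trans_le hx.1

/-- A function with a weak derivative is a constant plus the primitive of the weak derivative. -/
theorem exists_ae_eq_const_add_primitive [CompleteSpace X] {t₀ : ℝ} {u v : ℝ → X}
    (hu : ExpIntegrable t₀ u) (hv : ExpIntegrable t₀ v) (h : IsWeakDeriv t₀ u v) :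
    ∃ c : X, ∀ᵐ t ∂volume.restrict (Ioi t₀), u t = c + volterra (idKernel X) t₀ v t := by
  set w : ℝ → X := fun t => u t - volterra (idKernel X) t₀ v t with hw
  have hV : ExpIntegrable t₀ (volterra (idKernel X) t₀ v) :=
    isConvKernel_idKernel.expIntegrable_volterra hv
  have hwl : LocallyIntegrableOn w (Ioi t₀) := (hu.sub hV).locallyIntegrableOn
  have hint : ∀ {f : ℝ → X} {g : ℝ → ℝ}, ExpIntegrable t₀ f → Continuous g →
      HasCompactSupport g → IntegrableOn (fun t => g t • f t) (Ioi t₀) := by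
    intro f g hf hg hgc
    have := (LocallyIntegrable.integrable_smul_left_of_hasCompactSupport
      hf.locallyIntegrable_indicator hg hgc).integrableOn (s := Ioi t₀)
    refine this.congr_fun (fun t ht => ?_) measurableSet_Ioi
    simp only [indicator_of_mem ht]
  have hwd : ∀ φ : ℝ → ℝ, ContDiff ℝ ∞ φ → HasCompactSupport φ → tsupport φ ⊆ Ioi t₀ →
      ∫ t in Ioi t₀, deriv φ t • w t = 0 := by
    intro φ hφ hφc hφs
    have hφ' : Continuous (deriv φ) := hφ.continuous_deriv (by exact_mod_cast le_top)
    simp_rw [hw, smul_sub]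
    rw [integral_sub (hint hu hφ' hφc.deriv) (hint hV hφ' hφc.deriv), h φ hφ hφc hφs,
      hv.integral_deriv_smul_primitive hφ hφc, sub_self]
  -- A unit-mass bump supported in [t₀ + 1, t₀ + 3], hence inside J.
  let η₀ : ContDiffBump (t₀ + 2 : ℝ) := ⟨1 / 2, 1, by norm_num, by norm_num⟩
  set η : ℝ → ℝ := η₀.normed volume with hη
  have hη1 : ContDiff ℝ ∞ η := η₀.contDiff_normed
  have hηc : HasCompactSupport η := η₀.hasCompactSupport_normed
  have hηs : tsupport η ⊆ Ioi t₀ := by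
    rw [hη, η₀.tsupport_normed_eq, Real.closedBall_eq_Icc]
    intro x hx
    have : t₀ + 2 - 1 ≤ x := hx.1
    exact mem_Ioi.2 (by linarith)
  have hηi : ∫ t, η t = 1 := η₀.integral_normed
  set c : X := ∫ t in Ioi t₀, η t • w t
  refine ⟨c, ?_⟩
  have hkey : ∀ᵐ t, t ∈ Ioi t₀ → w t - c = 0 := by
    refine isOpen_Ioi.ae_eq_zero_of_integral_contDiff_smul_eq_zero
      (hwl.sub (ExpIntegrable.const t₀ c).locallyIntegrableOn) fun φ hφ hφc hφs => ?_
    -- Du Bois-Reymond: φ - mη has mean zero, so it is the derivative of a test function and w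
    -- annihilates it; thus ∫ φ w = m c.
    set m := ∫ t, φ t
    have hθs : tsupport (fun t => φ t - m * η t) ⊆ Ioi t₀ := by
      refine (tsupport_sub φ _).trans (union_subset hφs ?_)
      exact (tsupport_mul_subset_right (f := fun _ => m)).trans hηs
    obtain ⟨ψ, hψ, hψc, hψs, hψd⟩ := exists_testFunction_deriv_eq (t₀ := t₀)
      (θ := fun t => φ t - m * η t) (hφ.sub (contDiff_const.mul hη1))
      (hφc.sub hηc.mul_left) hθs (by
        rw [integral_sub (hφ.continuous.integrable_of_hasCompactSupport hφc)
          ((hη1.continuous.integrable_of_hasCompactSupport hηc).const_mul m),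
          integral_const_mul, hηi, mul_one, sub_self])
    have h1 := hwd ψ hψ hψc hψs
    rw [hψd] at h1
    have hwE : ExpIntegrable t₀ w := hu.sub hV
    have h2 : ∫ t in Ioi t₀, (φ t - m * η t) • w t = (∫ t in Ioi t₀, φ t • w t) - m • c := by
      simp_rw [sub_smul, mul_smul]
      rw [integral_sub (hint hwE hφ.continuous hφc)
        (g := fun t => m • η t • w t) ((hint hwE hη1.continuous hηc).smul m), integral_smul]
    have h3 : ∫ t in Ioi t₀, φ t = m :=
      setIntegral_eq_integral_of_forall_compl_eq_zero fun t ht =>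
        image_eq_zero_of_notMem_tsupport fun h => ht (hφs h)
    have h4 : ∫ t, φ t • (w t - c) = ∫ t in Ioi t₀, φ t • (w t - c) := by
      refine (setIntegral_eq_integral_of_forall_compl_eq_zero fun t ht => ?_).symm
      rw [image_eq_zero_of_notMem_tsupport fun h => ht (hφs h), zero_smul]
    rw [h4]
    simp_rw [smul_sub]
    rw [integral_sub (hint hwE hφ.continuous hφc)
      (hint (ExpIntegrable.const t₀ c) hφ.continuous hφc), integral_smul_const, h3, ← h2, h1]
  rw [ae_restrict_iff' measurableSet_Ioi]
  filter_upwards [hkey] with t ht htt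
  have := sub_eq_zero.1 (ht htt)
  rw [← this, hw, sub_add_cancel]

end WeakDerivative

/-! ### Variation of constants and its iteration. -/

section VariationOfConstants

variable {X : Type*} [NormedAddCommGroup X] [NormedSpace ℂ X]

theorem IsConvKernel.expIntegrable_apply {K : ℝ → X →L[ℂ] X} (hK : IsConvKernel K) (t₀ : ℝ)
    (c : X) : ExpIntegrable t₀ fun t => K (t - t₀) c := by
  obtain ⟨κ, hκ, hb⟩ := hK.exists_bound_expKernel
  have h1 : Integrable fun r => expKernel K r c :=
    (hκ.mul_const ‖c‖).mono' (hK.aestronglyMeasurable_expKernel c)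
      (Eventually.of_forall fun r => (expKernel K r).le_of_opNorm_le (hb r) c)
  have h2 := ((h1.comp_sub_right t₀).smul (Real.exp (-t₀))).integrableOn (s := Ioi t₀)
  refine h2.congr_fun (fun t ht => ?_) measurableSet_Ioi
  have ht' : t - t₀ ∈ Ioi (0 : ℝ) := sub_pos.2 (mem_Ioi.1 ht)
  simp only [Pi.smul_apply, expKernel, indicator_of_mem ht', _root_.smul_apply, smul_smul,
    ← Real.exp_add]
  congr 2
  ring

theorem IsConvKernel.volterra_sum {K : ℝ → X →L[ℂ] X} (hK : IsConvKernel K) {t₀ : ℝ} {ι : Type*}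
    (s : Finset ι) {u : ι → ℝ → X} (hu : ∀ i ∈ s, ExpIntegrable t₀ (u i)) :
    ∀ᵐ t, volterra K t₀ (fun τ => ∑ i ∈ s, u i τ) t = ∑ i ∈ s, volterra K t₀ (u i) t := by
  have h : ∀ᵐ t, ∀ i ∈ s, IntegrableOn (fun τ => K (t - τ) (u i τ)) (Ioo t₀ t) :=
    (Finset.eventually_all s).2 fun i hi => hK.ae_integrableOn (hu i hi)
  filter_upwards [h] with t ht
  simp only [volterra, map_sum]
  exact integral_finsetSum s ht

theorem ExpIntegrable.sum {t₀ : ℝ} {ι : Type*} (s : Finset ι) {u : ι → ℝ → X}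
    (hu : ∀ i ∈ s, ExpIntegrable t₀ (u i)) : ExpIntegrable t₀ fun t => ∑ i ∈ s, u i t := by
  simp only [ExpIntegrable, Finset.smul_sum]
  exact integrable_finsetSum s hu

variable {S : ℝ → X →L[ℂ] X} {A : X →ₗ.[ℂ] X} {z : ℝ} {R : X →L[ℂ] X}

theorem FracParabolic.IsParabolicPow.memLp_right {p : ℝ≥0∞} {t₀ : ℝ} {n : ℕ} {w f : ℝ → X}
    (h : IsParabolicPow A p t₀ n w f) : MemLp f p (volume.restrict (Ioi t₀)) := by
  induction n generalizing w with
  | zero => exact h.1.ae_eq h.2.symm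
  | succ n ih =>
    obtain ⟨g, -, hg⟩ := h
    exact ih hg

theorem expIntegrable_fracInt (hS : IsMeasurableSemigroup S) (hb : IsUniformlyBounded S)
    {t₀ σ : ℝ} (hσ : 0 ≤ σ) {f : ℝ → X} (hf : ExpIntegrable t₀ f) :
    ExpIntegrable t₀ (fracInt S t₀ σ f) := by
  rcases hσ.eq_or_lt with rfl | h
  · have : fracInt S t₀ 0 f = f := by
      ext t
      simp [fracInt]
    rwa [this]
  · rw [fracInt_eq_volterra S t₀ h.ne']
    exact (isConvKernel_powKernel hS hb h).expIntegrable_volterra hf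

variable [CompleteSpace X]

namespace IsSemigroupResolvent

/-- The integrated form of `(S * u)' = u - S * (A u)`. -/
theorem volterra_semigroup_eq (hR : IsSemigroupResolvent S A z R) (hS : IsMeasurableSemigroup S)
    (hb : IsUniformlyBounded S) {t₀ : ℝ} {u : ℝ → X} (hu : ExpIntegrable t₀ u)
    (hD : ∀ᵐ t ∂volume.restrict (Ioi t₀), u t ∈ A.domain)
    (hAu : ExpIntegrable t₀ fun t => opApply A (u t)) :
    ∀ᵐ t, volterra S t₀ u t = volterra (idKernel X) t₀ u t -
      volterra (idKernel X) t₀ (volterra S t₀ fun τ => opApply A (u τ)) t := by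
  have hK := isConvKernel_semigroup hS hb
  have hI : IsConvKernel (idKernel X) := isConvKernel_idKernel
  filter_upwards [hI.volterra_volterra hK hAu, hK.ae_integrableOn hu, hI.ae_integrableOn hu]
    with t h1 h2 h3
  -- For almost every ρ, u(ρ) ∈ D(A) gives ∫₀^{t-ρ} S(σ) A u(ρ) dσ = u(ρ) - S(t - ρ) u(ρ).
  have h4 : ∫ ρ in Ioo t₀ t, volterra (idKernel X) 0 (fun σ => S σ (opApply A (u ρ))) (t - ρ) =
      ∫ ρ in Ioo t₀ t, (idKernel X (t - ρ) (u ρ) - S (t - ρ) (u ρ)) := by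
    refine integral_congr_ae ?_
    filter_upwards [ae_restrict_mem measurableSet_Ioo,
      ae_restrict_of_ae_restrict_of_subset Ioo_subset_Ioi_self hD] with ρ hρ hρD
    rw [hR.semigroup_apply hS hb hρD (sub_nonneg.2 hρ.2.le), volterra_idKernel]
    simp [idKernel]
  rw [h1, h4, integral_sub h3 h2]
  simp only [volterra, sub_sub_cancel]

/-- Convolution with the semigroup is injective. -/
theorem ae_eq_zero_of_volterra_semigroup (hR : IsSemigroupResolvent S A z R)
    (hS : IsMeasurableSemigroup S) (hb : IsUniformlyBounded S) {t₀ : ℝ} {h : ℝ → X}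
    (hh : ExpIntegrable t₀ h)
    (h0 : ∀ᵐ t ∂volume.restrict (Ioi t₀), volterra S t₀ h t = 0) :
    ∀ᵐ t ∂volume.restrict (Ioi t₀), h t = 0 := by
  have hK := isConvKernel_semigroup hS hb
  -- Smoothing to y = R h gives D(A)-valued data: S * y = R (S * h) = 0 and S * A y = S * (h - z y)
  -- = 0. The integrated identity then makes the primitive of y vanish.
  have hy : ExpIntegrable t₀ fun t => R (h t) := hh.clm_comp R
  have hAy : ExpIntegrable t₀ fun t => opApply A (R (h t)) := by
    simp_rw [hR.opApply_apply]
    exact hh.sub (hy.smul z)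
  have h1 : ∀ᵐ t ∂volume.restrict (Ioi t₀), volterra S t₀ (fun τ => R (h τ)) t = 0 := by
    filter_upwards [h0, ae_restrict_of_ae (hK.ae_integrableOn hh)] with t ht hti
    have : volterra S t₀ (fun τ => R (h τ)) t = R (volterra S t₀ h t) := by
      rw [volterra, volterra, ← R.integral_comp_comm hti]
      exact setIntegral_congr_fun measurableSet_Ioo fun τ hτ =>
        (hR.comm _ (sub_nonneg.2 hτ.2.le) _).symm
    rw [this, ht, map_zero]
  have h2 : ∀ᵐ t ∂volume.restrict (Ioi t₀),
      volterra S t₀ (fun τ => opApply A (R (h τ))) t = 0 := by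
    simp_rw [hR.opApply_apply]
    filter_upwards [h0, h1, ae_restrict_of_ae (hK.volterra_sub hh (hy.smul z))] with t ht ht1 ht2
    have : volterra S t₀ (fun τ => z • R (h τ)) t = z • volterra S t₀ (fun τ => R (h τ)) t := by
      simp only [volterra, ContinuousLinearMap.map_smul_of_tower]
      exact integral_smul z _
    rw [ht2, ht, this, ht1, smul_zero, sub_zero]
  have h3 : ∀ᵐ t ∂volume.restrict (Ioi t₀),
      volterra (idKernel X) t₀ (fun τ => R (h τ)) t = 0 := by
    filter_upwards [h1, ae_restrict_of_ae (hR.volterra_semigroup_eq hS hb hy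
      (Eventually.of_forall fun t => hR.mem_domain _) hAy)] with t ht1 ht2
    rw [ht1, volterra_congr_ae (v := fun _ => 0) h2, volterra_idKernel (u := fun _ => 0),
      integral_zero, sub_zero] at ht2
    exact ht2.symm
  filter_upwards [hy.ae_eq_zero_of_primitive h3] with t ht
  exact hR.injective (by rw [ht, map_zero])

/-- The variation of constants formula, for the weak formulation of `u' + A u = f`. -/
theorem variation_of_constants (hR : IsSemigroupResolvent S A z R)
    (hS : IsMeasurableSemigroup S) (hb : IsUniformlyBounded S) {t₀ : ℝ} {u v f : ℝ → X} {c : X}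
    (hu : ExpIntegrable t₀ u) (hv : ExpIntegrable t₀ v)
    (hD : ∀ᵐ t ∂volume.restrict (Ioi t₀), u t ∈ A.domain)
    (hAu : ExpIntegrable t₀ fun t => opApply A (u t))
    (huv : ∀ᵐ t ∂volume.restrict (Ioi t₀), u t = c + volterra (idKernel X) t₀ v t)
    (hf : f =ᵐ[volume.restrict (Ioi t₀)] fun t => v t + opApply A (u t)) :
    ∀ᵐ t ∂volume.restrict (Ioi t₀), u t = S (t - t₀) c + volterra S t₀ f t := by
  have hK := isConvKernel_semigroup hS hb
  have hI : IsConvKernel (idKernel X) := isConvKernel_idKernel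
  have hSc : ExpIntegrable t₀ fun t => S (t - t₀) c := hK.expIntegrable_apply t₀ c
  have hSv := hK.expIntegrable_volterra hv
  have hSAu := hK.expIntegrable_volterra hAu
  have hSf : volterra S t₀ f =ᵐ[volume.restrict (Ioi t₀)] fun t =>
      volterra S t₀ v t + volterra S t₀ (fun τ => opApply A (u τ)) t := by
    rw [volterra_congr_ae hf]
    exact ae_restrict_of_ae (hK.volterra_add hv hAu)
  -- The defect of the formula. Inserting u = c + ∫ v into the integrated identity for S * u shows
  -- that its primitive vanishes, so no orbit has to be differentiated.
  set h : ℝ → X := fun t => (S (t - t₀) c + (volterra S t₀ v t +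
    volterra S t₀ (fun τ => opApply A (u τ)) t)) - u t with hh_def
  have hh : ExpIntegrable t₀ h := (hSc.add (hSv.add hSAu)).sub hu
  have hz : ∀ᵐ t ∂volume.restrict (Ioi t₀), volterra (idKernel X) t₀ h t = 0 := by
    have e2 := hK.volterra_add (ExpIntegrable.const t₀ c) (hI.expIntegrable_volterra hv)
    filter_upwards [ae_restrict_mem measurableSet_Ioi,
      ae_restrict_of_ae (hR.volterra_semigroup_eq hS hb hu hD hAu), ae_restrict_of_ae e2,
      ae_restrict_of_ae (volterra_semigroup_idKernel hS hb hv),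
      ae_restrict_of_ae (hI.volterra_sub (hSc.add (hSv.add hSAu)) hu),
      ae_restrict_of_ae (hI.volterra_add hSc (hSv.add hSAu)),
      ae_restrict_of_ae (hI.volterra_add hSv hSAu)] with t ht h1 h2 h3 h4 h5 h6
    rw [volterra_congr_ae huv, h2, volterra_semigroup_const (le_of_lt ht), h3] at h1
    rw [hh_def, h4, h5, h6, volterra_idKernel _ (fun t => S (t - t₀) c), ← add_assoc, h1]
    abel
  filter_upwards [hh.ae_eq_zero_of_primitive hz, hSf] with t ht hft
  rw [hft]
  exact (sub_eq_zero.1 ht).symm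

end IsSemigroupResolvent

/-- The continuous representative of `u` in the domain of `∂_t + A`. -/
theorem FracParabolic.IsParabolic.exists_continuous_representative {p : ℝ≥0∞} (hp : 1 ≤ p)
    {t₀ : ℝ} (hR : IsSemigroupResolvent S A z R) (hS : IsMeasurableSemigroup S)
    (hb : IsUniformlyBounded S) {u f : ℝ → X} (h : IsParabolic A p t₀ u f) :
    ∃ g : ℝ → X, ContinuousOn g (Ici t₀) ∧ g =ᵐ[volume.restrict (Ioi t₀)] u ∧
      ∀ᵐ t ∂volume.restrict (Ioi t₀), u t = S (t - t₀) (g t₀) + volterra S t₀ f t := by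
  obtain ⟨hu, hD, hAu, v, hv, hweak, hf⟩ := h
  have hu' := ExpIntegrable.of_memLp hp hu
  have hv' := ExpIntegrable.of_memLp hp hv
  obtain ⟨c, hc⟩ := exists_ae_eq_const_add_primitive hu' hv' hweak
  refine ⟨fun t => c + volterra (idKernel X) t₀ v t,
    continuousOn_const.add hv'.continuousOn_primitive, ?_, ?_⟩
  · filter_upwards [hc] with t ht using ht.symm
  · simp only [volterra_of_le (idKernel X) v (le_refl t₀), add_zero]
    exact hR.variation_of_constants hS hb hu' hv' hD (ExpIntegrable.of_memLp hp hAu) hc hf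

/-- This is the index law with orders 1 and n; n = 0 is separate because I^0 is the identity by
definition, not a convolution. -/
theorem volterra_semigroup_fracInt_natCast (hS : IsMeasurableSemigroup S)
    (hb : IsUniformlyBounded S) {t₀ : ℝ} (n : ℕ) {f : ℝ → X} (hf : ExpIntegrable t₀ f) :
    ∀ᵐ t, volterra S t₀ (fracInt S t₀ n f) t = fracInt S t₀ (n + 1 : ℕ) f t := by
  rcases Nat.eq_zero_or_pos n with rfl | hn
  · refine Eventually.of_forall fun t => ?_
    have : fracInt S t₀ ((0 : ℕ) : ℝ) f = f := by
      ext t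
      simp [fracInt]
    rw [this, fracInt_eq_volterra S t₀ (by positivity)]
    simp [powKernel_one]
  · have hn' : (0 : ℝ) < n := by exact_mod_cast hn
    rw [fracInt_eq_volterra S t₀ hn'.ne', fracInt_eq_volterra S t₀ (by positivity)]
    have := volterra_powKernel_volterra_powKernel hS hb one_pos hn' hf
    rw [powKernel_one] at this
    filter_upwards [this] with t ht
    rw [ht]
    push_cast
    rw [add_comm]

/-- Iterated variation of constants: the Taylor type expansion of a function in the domain of
`(∂_t + A)^n`. -/
theorem FracParabolic.IsParabolicPow.exists_expansion {p : ℝ≥0∞} (hp : 1 ≤ p) {t₀ : ℝ}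
    (hR : IsSemigroupResolvent S A z R) (hS : IsMeasurableSemigroup S)
    (hb : IsUniformlyBounded S) {n : ℕ} {w f : ℝ → X} (h : IsParabolicPow A p t₀ n w f) :
    ∃ g : ℕ → ℝ → X,
      (∀ k < n, ContinuousOn (g k) (Ici t₀) ∧ IsParabolicPow A p t₀ k w (g k)) ∧
      ∀ᵐ t ∂volume.restrict (Ioi t₀), w t =
        ∑ k ∈ Finset.range n, powKernel S (k + 1) (t - t₀) (g k t₀) + fracInt S t₀ n f t := by
  induction n generalizing w with
  | zero =>
    refine ⟨fun _ => w, fun k hk => absurd hk (Nat.not_lt_zero k), ?_⟩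
    filter_upwards [h.2] with t ht
    simp [fracInt, ht]
  | succ n ih =>
    obtain ⟨w', hw, hw'⟩ := h
    obtain ⟨g, hg, hexp⟩ := ih hw'
    obtain ⟨g₀, hg₀c, hg₀, hvoc⟩ := hw.exists_continuous_representative hp hR hS hb
    have hf := ExpIntegrable.of_memLp hp hw'.memLp_right
    have hK := isConvKernel_semigroup hS hb
    have hP : ∀ k : ℕ, ExpIntegrable t₀ fun t => powKernel S (k + 1) (t - t₀) (g k t₀) := fun k =>
      (isConvKernel_powKernel hS hb (by positivity)).expIntegrable_apply t₀ _
    -- The representatives for (∂_t + A) w move up one index, making room for that of w at index 0.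
    refine ⟨fun k => Nat.casesOn k g₀ g, ?_, ?_⟩
    · rintro (_ | k) hk
      · exact ⟨hg₀c, hw.1, hg₀⟩
      · exact ⟨(hg k (Nat.lt_of_succ_lt_succ hk)).1, w', hw, (hg k (Nat.lt_of_succ_lt_succ hk)).2⟩
    · filter_upwards [ae_restrict_mem measurableSet_Ioi, hvoc,
        ae_restrict_of_ae (volterra_semigroup_fracInt_natCast hS hb n hf),
        ae_restrict_of_ae (hK.volterra_sum (Finset.range n) fun k _ => hP k),
        ae_restrict_of_ae (hK.volterra_add
          (ExpIntegrable.sum (Finset.range n) fun k _ => hP k)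
          (expIntegrable_fracInt hS hb n.cast_nonneg hf))] with t ht h1 h2 h3 h4
      rw [h1, volterra_congr_ae hexp, h4, h3, h2, Finset.sum_range_succ']
      have h5 : ∀ k ∈ Finset.range n, volterra S t₀
          (fun τ => powKernel S (k + 1) (τ - t₀) (g k t₀)) t =
            powKernel S ((k + 1 : ℕ) + 1) (t - t₀) (g k t₀) := by
        intro k _
        have := volterra_powKernel_powKernel_apply hS one_pos (b := (k : ℝ) + 1) (by positivity)
          ht (g k t₀)
        rw [powKernel_one] at this
        rw [this]
        push_cast
        rw [add_comm (1 : ℝ)]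
      rw [Finset.sum_congr rfl h5]
      simp only [Nat.cast_zero, zero_add, powKernel_one]
      rw [← add_assoc, add_comm (S _ _)]
      rfl

end VariationOfConstants

/-! ### Injectivity of fractional integrals and the Riemann–Liouville case. -/

section RiemannLiouville

variable {X : Type*} [NormedAddCommGroup X] [NormedSpace ℂ X]

theorem natCast_floor_add_fract {s : ℝ} (hs : 0 ≤ s) : (⌊s⌋₊ : ℝ) + Int.fract s = s := by
  rw [natCast_floor_eq_intCast_floor hs, Int.floor_add_fract]

theorem fract_pos_of_ne_natCast {s : ℝ} (hs : 0 ≤ s) (hsN : ∀ m : ℕ, s ≠ m) :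
    0 < Int.fract s := by
  refine (Int.fract_nonneg s).lt_of_ne fun h => hsN ⌊s⌋₊ ?_
  have := natCast_floor_add_fract hs
  rw [← h, add_zero] at this
  exact this.symm

theorem natCeil_natCast_add {k : ℕ} {x : ℝ} (h0 : 0 < x) (h1 : x ≤ 1) : ⌈(k : ℝ) + x⌉₊ = k + 1 := by
  rw [Nat.ceil_eq_iff (Nat.succ_ne_zero k)]
  constructor
  · push_cast [Nat.succ_sub_one]
    linarith
  · push_cast
    linarith

theorem natCeil_eq_floor_add_one {s : ℝ} (hs : 0 ≤ s) (hsN : ∀ m : ℕ, s ≠ m) :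
    ⌈s⌉₊ = ⌊s⌋₊ + 1 := by
  nth_rw 1 [← natCast_floor_add_fract hs]
  exact natCeil_natCast_add (fract_pos_of_ne_natCast hs hsN) (Int.fract_lt_one s).le

variable {S : ℝ → X →L[ℂ] X} {A : X →ₗ.[ℂ] X} {z : ℝ} {R : X →L[ℂ] X}

theorem ae_integrableOn_fracIntegrand (hS : IsMeasurableSemigroup S) (hb : IsUniformlyBounded S)
    {t₀ σ : ℝ} (hσ : 0 < σ) {f : ℝ → X} (hf : ExpIntegrable t₀ f) :
    ∀ᵐ t, IntegrableOn (fracIntegrand S σ f t) (Ioo t₀ t) := by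
  filter_upwards [(isConvKernel_powKernel hS hb hσ).ae_integrableOn hf] with t ht
  refine (ht.smul (Real.Gamma σ)).congr (Eventually.of_forall fun τ => ?_)
  have := (Real.Gamma_pos_of_pos hσ).ne'
  simp only [Pi.smul_apply, powKernel_apply, smul_smul, fracIntegrand]
  congr 1
  field_simp

variable [CompleteSpace X]

/-- Convolution with the kernel of a fractional parabolic integral of order less than one is
injective. -/
theorem ae_eq_zero_of_volterra_powKernel (hR : IsSemigroupResolvent S A z R)
    (hS : IsMeasurableSemigroup S) (hb : IsUniformlyBounded S) {t₀ α : ℝ} (hα : 0 < α)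
    (hα1 : α < 1) {h : ℝ → X} (hh : ExpIntegrable t₀ h)
    (h0 : ∀ᵐ t ∂volume.restrict (Ioi t₀), volterra (powKernel S α) t₀ h t = 0) :
    ∀ᵐ t ∂volume.restrict (Ioi t₀), h t = 0 := by
  refine hR.ae_eq_zero_of_volterra_semigroup hS hb hh ?_
  -- Applying I^{1-α} raises the order to exactly 1, where injectivity is known.
  have h1 := volterra_powKernel_volterra_powKernel hS hb (sub_pos.2 hα1) hα hh
  rw [sub_add_cancel, powKernel_one, volterra_congr_ae (v := fun _ => 0) h0] at h1
  filter_upwards [ae_restrict_of_ae h1] with t ht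
  rw [← ht]
  simp [volterra]

/-- The expansion of `u` in terms of the initial values of the Riemann–Liouville type derivatives,
deduced from the expansion of `I^{1-θ} u`. -/
theorem ae_eq_sum_powKernel_add_fracInt (hR : IsSemigroupResolvent S A z R)
    (hS : IsMeasurableSemigroup S) (hb : IsUniformlyBounded S) {t₀ θ : ℝ} (hθ : 0 < θ)
    (hθ1 : θ < 1) {N : ℕ} {u f : ℝ → X} {c : ℕ → X} (hu : ExpIntegrable t₀ u)
    (hf : ExpIntegrable t₀ f)
    (h : ∀ᵐ t ∂volume.restrict (Ioi t₀), fracInt S t₀ (1 - θ) u t =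
      ∑ k ∈ Finset.range (N + 1), powKernel S (k + 1) (t - t₀) (c k) +
        fracInt S t₀ (N + 1 : ℕ) f t) :
    ∀ᵐ t ∂volume.restrict (Ioi t₀), u t =
      ∑ k ∈ Finset.range (N + 1), powKernel S (k + θ) (t - t₀) (c k) + fracInt S t₀ (N + θ) f t := by
  have hα : 0 < 1 - θ := sub_pos.2 hθ1
  have hNθ : 0 < N + θ := by positivity
  have hK := isConvKernel_powKernel hS hb hα
  have hP : ∀ k : ℕ, ExpIntegrable t₀ fun t => powKernel S (k + θ) (t - t₀) (c k) := fun k =>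
    (isConvKernel_powKernel hS hb (by positivity)).expIntegrable_apply t₀ _
  have hsum := ExpIntegrable.sum (Finset.range (N + 1)) fun k _ => hP k
  have hI := expIntegrable_fracInt hS hb hNθ.le hf
  rw [fracInt_eq_volterra S t₀ hα.ne', fracInt_eq_volterra S t₀ (by positivity)] at h
  rw [fracInt_eq_volterra S t₀ hNθ.ne'] at hI ⊢
  -- Under I^{1-θ} the orders k + θ and N + θ become k + 1 and N + 1, so the difference of the two
  -- sides is mapped to zero by the hypothesis.
  have key := ae_eq_zero_of_volterra_powKernel hR hS hb hα (by linarith)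
    (hu.sub (hsum.add hI)) (by
      filter_upwards [ae_restrict_mem measurableSet_Ioi, h,
        ae_restrict_of_ae (hK.volterra_sub hu (hsum.add hI)),
        ae_restrict_of_ae (hK.volterra_add hsum hI),
        ae_restrict_of_ae (hK.volterra_sum (Finset.range (N + 1)) fun k _ => hP k),
        ae_restrict_of_ae (volterra_powKernel_volterra_powKernel hS hb hα hNθ hf)]
        with t ht h1 h2 h3 h4 h5
      rw [h2, h3, h4, h5, h1, sub_eq_zero]
      congr 1
      · refine Finset.sum_congr rfl fun k _ => ?_
        rw [volterra_powKernel_powKernel_apply hS hα (by positivity) ht]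
        congr 2
        ring
      · congr 2
        push_cast
        ring)
  filter_upwards [key] with t ht
  exact sub_eq_zero.1 ht

/-- For 1 ≤ k ≤ ⌊s⌋ the order k + {s} - 1 has ceiling k, so its derivative is built on the same
I^{1-{s}} u. The intermediate functions of the iterated expansion are therefore the required lower
derivatives. -/
theorem riemannLiouville_expansion (hR : IsSemigroupResolvent S A z R)
    (hS : IsMeasurableSemigroup S) (hb : IsUniformlyBounded S) {s : ℝ} (hs : 0 < s)
    (hsN : ∀ m : ℕ, s ≠ m) {t₀ : ℝ} {p : ℝ≥0∞} (hp : 1 ≤ p) {u f : ℝ → X}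
    (h : IsRLDeriv S A p t₀ s u f) :
    ∃ g : ℕ → ℝ → X,
      (∀ k ≤ ⌊s⌋₊, ContinuousOn (g k) (Ici t₀)) ∧
      g 0 =ᵐ[volume.restrict (Ioi t₀)] fracInt S t₀ (1 - Int.fract s) u ∧
      (∀ k : ℕ, 1 ≤ k → k ≤ ⌊s⌋₊ → IsRLDeriv S A p t₀ (k + Int.fract s - 1) u (g k)) ∧
      ∀ᵐ t ∂volume.restrict (Ioi t₀),
        IntegrableOn (fracIntegrand S s f t) (Ioo t₀ t) ∧
        fracInt S t₀ s f t =
          u t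
          - ((t - t₀) ^ (Int.fract s - 1) / Real.Gamma (Int.fract s)) • S (t - t₀) (g 0 t₀)
          - ∑ k ∈ Finset.Icc 1 ⌊s⌋₊,
              ((t - t₀) ^ (k + Int.fract s - 1) / Real.Gamma (k + Int.fract s)) •
                S (t - t₀) (g k t₀) := by
  obtain ⟨hu, hpow⟩ := h
  have hθ := fract_pos_of_ne_natCast hs.le hsN
  have hθ1 := Int.fract_lt_one s
  have hsum := natCast_floor_add_fract hs.le
  have hceil := natCeil_eq_floor_add_one hs.le hsN
  rw [hceil, show (((⌊s⌋₊ + 1 : ℕ) : ℝ) - s) = 1 - Int.fract s by push_cast; linarith] at hpow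
  obtain ⟨g, hg, hexp⟩ := hpow.exists_expansion hp hR hS hb
  have hf := ExpIntegrable.of_memLp hp hpow.memLp_right
  have hmain := ae_eq_sum_powKernel_add_fracInt hR hS hb hθ hθ1 (ExpIntegrable.of_memLp hp hu)
    hf hexp
  rw [hsum] at hmain
  refine ⟨g, fun k hk => (hg k (Nat.lt_succ_of_le hk)).1, (hg 0 (Nat.succ_pos _)).2.2,
    fun k hk1 hk => ⟨hu, ?_⟩, ?_⟩
  · obtain ⟨m, rfl⟩ := Nat.exists_eq_add_of_le' hk1
    have hc : ⌈((m + 1 : ℕ) : ℝ) + Int.fract s - 1⌉₊ = m + 1 := by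
      rw [show ((m + 1 : ℕ) : ℝ) + Int.fract s - 1 = m + Int.fract s by push_cast; ring]
      exact natCeil_natCast_add hθ hθ1.le
    rw [hc, show (((m + 1 : ℕ) : ℝ) - (((m + 1 : ℕ) : ℝ) + Int.fract s - 1)) = 1 - Int.fract s by
      ring]
    exact (hg (m + 1) (Nat.lt_succ_of_le hk)).2
  · filter_upwards [hmain, ae_restrict_of_ae (ae_integrableOn_fracIntegrand hS hb hs hf)]
      with t ht hti
    refine ⟨hti, ?_⟩
    rw [ht, Finset.range_eq_Ico, Finset.sum_eq_sum_Ico_succ_bot (Nat.succ_pos _), zero_add,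
      Nat.succ_eq_add_one, Finset.Ico_add_one_right_eq_Icc]
    simp only [powKernel_apply, Nat.cast_zero, zero_add]
    abel

end RiemannLiouville

/-! ### Leibniz formula for powers of ∂_t + A and the Caputo case. -/

section Caputo

variable {X : Type*} [NormedAddCommGroup X] [NormedSpace ℂ X]
variable {S : ℝ → X →L[ℂ] X} {A : X →ₗ.[ℂ] X} {z : ℝ} {R : X →L[ℂ] X}

theorem opPow_succ (A : X →ₗ.[ℂ] X) (l : ℕ) (x : X) :
    opPow A (l + 1) x = opApply A (opPow A l x) :=
  Function.iterate_succ_apply' _ _ _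

theorem IsSemigroupResolvent.opPow_semigroup (hR : IsSemigroupResolvent S A z R) {t : ℝ}
    (ht : 0 ≤ t) {l : ℕ} {x : X} (hx : x ∈ domPow A l) :
    opPow A l (S t x) = S t (opPow A l x) := by
  induction l with
  | zero => rfl
  | succ l ih =>
    rw [opPow_succ, opPow_succ, ih fun m hm => hx m (Nat.lt_succ_of_lt hm),
      hR.opApply_semigroup ht (hx l (Nat.lt_succ_self l))]

theorem iteratedDerivWithin_clm_comp (R : X →L[ℂ] X) {s : Set ℝ} (hs : UniqueDiffOn ℝ s) {i : ℕ}
    {f : ℝ → X} (hf : ContDiffOn ℝ i f s) {t : ℝ} (ht : t ∈ s) :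
    iteratedDerivWithin i (fun t => R (f t)) s t = R (iteratedDerivWithin i f s t) := by
  have h := (R.restrictScalars ℝ).iteratedFDerivWithin_comp_left (hf t ht) hs ht le_rfl
  rw [iteratedDerivWithin, iteratedDerivWithin]
  exact congrArg (fun F => F fun _ => (1 : ℝ)) h

/-- Closedness of `A`: iterated derivatives commute with `A`. -/
theorem IsSemigroupResolvent.iteratedDerivWithin_opApply (hR : IsSemigroupResolvent S A z R)
    {s : Set ℝ} (hs : UniqueDiffOn ℝ s) {i : ℕ} {y : ℝ → X} (hy : ContDiffOn ℝ i y s)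
    (hyD : ∀ t ∈ s, y t ∈ A.domain) (hAy : ContDiffOn ℝ i (fun t => opApply A (y t)) s)
    {t : ℝ} (ht : t ∈ s) :
    iteratedDerivWithin i y s t ∈ A.domain ∧
      opApply A (iteratedDerivWithin i y s t) =
        iteratedDerivWithin i (fun t => opApply A (y t)) s t := by
  apply hR.mem_domain_of_eq
  have h1 : EqOn y (fun t => R (z • y t + opApply A (y t))) s := fun t ht =>
    (hR.apply_add (y t) (hyD t ht)).symm
  have h2 : ContDiffOn ℝ i (fun t => z • y t) s := hy.const_smul z
  rw [← iteratedDerivWithin_fun_const_smul_field, ← iteratedDerivWithin_fun_add ht hs (h2 t ht)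
    (hAy t ht), ← iteratedDerivWithin_clm_comp R hs (h2.add hAy) ht]
  exact iteratedDerivWithin_congr h1 ht

/-- `IsParabolicPow` peels off the innermost factor; the Leibniz induction needs the outermost one.
-/
theorem FracParabolic.IsParabolicPow.exists_last {p : ℝ≥0∞} {t₀ : ℝ} {n : ℕ} {u f : ℝ → X}
    (h : IsParabolicPow A p t₀ (n + 1) u f) :
    ∃ g, IsParabolicPow A p t₀ n u g ∧ IsParabolic A p t₀ g f := by
  induction n generalizing u with
  | zero =>
    obtain ⟨g, ⟨hu, hD, hAu, v, hv, hw, hg⟩, -, hf⟩ := h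
    exact ⟨u, ⟨hu, EventuallyEq.rfl⟩, hu, hD, hAu, v, hv, hw, hf.trans hg⟩
  | succ n ih =>
    obtain ⟨w, hw, hw'⟩ := h
    obtain ⟨g, hg, hg'⟩ := ih hw'
    exact ⟨g, ⟨w, hw, hg⟩, hg'⟩

/-- The Leibniz type expression `∑_{i + l = j} (j choose i) A^l u^{(i)}` for `(∂_t + A)^j u`. -/
noncomputable def parabolicLeibniz (A : X →ₗ.[ℂ] X) (t₀ : ℝ) (u : ℝ → X) (j : ℕ) (t : ℝ) : X :=
  ∑ q ∈ Finset.HasAntidiagonal.antidiagonal j,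
    j.choose q.1 • iteratedDerivWithin q.1 (fun t => opPow A q.2 (u t)) (Ici t₀) t

/-- Regularity of `u` of order `m` in `D(A^l)`, `l + i = m`. -/
structure IsMixedRegular (A : X →ₗ.[ℂ] X) (t₀ : ℝ) (m : ℕ) (u : ℝ → X) : Prop where
  mem : ∀ t ∈ Ici t₀, u t ∈ domPow A m
  contDiffOn : ∀ i l, i + l ≤ m → ContDiffOn ℝ i (fun t => opPow A l (u t)) (Ici t₀)

namespace IsMixedRegular

variable {t₀ : ℝ} {m : ℕ} {u : ℝ → X}

theorem iteratedDerivWithin_opPow_succ (hR : IsSemigroupResolvent S A z R)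
    (hu : IsMixedRegular A t₀ m u) {i l : ℕ} (hil : i + l < m) {t : ℝ} (ht : t ∈ Ici t₀) :
    iteratedDerivWithin i (fun t => opPow A l (u t)) (Ici t₀) t ∈ A.domain ∧
      opApply A (iteratedDerivWithin i (fun t => opPow A l (u t)) (Ici t₀) t) =
        iteratedDerivWithin i (fun t => opPow A (l + 1) (u t)) (Ici t₀) t := by
  have h := hR.iteratedDerivWithin_opApply (uniqueDiffOn_Ici t₀) (hu.contDiffOn i l hil.le)
    (fun t ht => hu.mem t ht l (by omega)) (by
      simp only [← opPow_succ]
      exact hu.contDiffOn i (l + 1) (by omega)) ht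
  simpa only [← opPow_succ] using h

theorem opPow_iteratedDerivWithin (hR : IsSemigroupResolvent S A z R)
    (hu : IsMixedRegular A t₀ m u) {i l : ℕ} (hil : i + l ≤ m) {t : ℝ} (ht : t ∈ Ici t₀) :
    opPow A l (iteratedDerivWithin i u (Ici t₀) t) =
      iteratedDerivWithin i (fun t => opPow A l (u t)) (Ici t₀) t := by
  induction l with
  | zero => rfl
  | succ l ih =>
    rw [opPow_succ, ih (by omega), (hu.iteratedDerivWithin_opPow_succ hR (by omega) ht).2]

theorem iteratedDerivWithin_mem_domPow (hR : IsSemigroupResolvent S A z R)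
    (hu : IsMixedRegular A t₀ m u) {i : ℕ} {t : ℝ} (ht : t ∈ Ici t₀) :
    iteratedDerivWithin i u (Ici t₀) t ∈ domPow A (m - i) := by
  intro l hl
  rw [hu.opPow_iteratedDerivWithin hR (by omega) ht]
  exact (hu.iteratedDerivWithin_opPow_succ hR (by omega) ht).1

theorem continuousOn_parabolicLeibniz (hu : IsMixedRegular A t₀ m u) {j : ℕ} (hj : j ≤ m) :
    ContinuousOn (parabolicLeibniz A t₀ u j) (Ici t₀) := by
  refine continuousOn_finsetSum _ fun q hq => ?_
  rw [Finset.HasAntidiagonal.mem_antidiagonal] at hq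
  exact ((hu.contDiffOn q.1 q.2 (by omega)).continuousOn_iteratedDerivWithin le_rfl
    (uniqueDiffOn_Ici t₀)).const_smul (j.choose q.1)

theorem hasDerivAt_parabolicLeibniz (hu : IsMixedRegular A t₀ m u) {j : ℕ} (hj : j < m) {t : ℝ}
    (ht : t₀ < t) :
    HasDerivAt (parabolicLeibniz A t₀ u j)
      (∑ q ∈ Finset.HasAntidiagonal.antidiagonal j,
        j.choose q.1 • iteratedDerivWithin (q.1 + 1) (fun t => opPow A q.2 (u t)) (Ici t₀) t) t := by
  refine HasDerivAt.fun_sum fun q hq => ?_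
  rw [Finset.HasAntidiagonal.mem_antidiagonal] at hq
  have h := (hu.contDiffOn (q.1 + 1) q.2 (by omega)).differentiableOn_iteratedDerivWithin
    (m := q.1) (by exact_mod_cast Nat.lt_succ_self _) (uniqueDiffOn_Ici t₀) t (mem_Ici.2 ht.le)
  rw [iteratedDerivWithin_succ]
  exact (h.hasDerivWithinAt.hasDerivAt (Ici_mem_nhds ht)).const_smul (j.choose q.1)

theorem opApply_parabolicLeibniz (hR : IsSemigroupResolvent S A z R)
    (hu : IsMixedRegular A t₀ m u) {j : ℕ} (hj : j < m) {t : ℝ} (ht : t ∈ Ici t₀) :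
    opApply A (parabolicLeibniz A t₀ u j t) =
      ∑ q ∈ Finset.HasAntidiagonal.antidiagonal j,
        j.choose q.1 • iteratedDerivWithin q.1 (fun t => opPow A (q.2 + 1) (u t)) (Ici t₀) t := by
  have hD : ∀ q ∈ Finset.HasAntidiagonal.antidiagonal j,
      iteratedDerivWithin q.1 (fun t => opPow A q.2 (u t)) (Ici t₀) t ∈ A.domain ∧
      opApply A (iteratedDerivWithin q.1 (fun t => opPow A q.2 (u t)) (Ici t₀) t) =
        iteratedDerivWithin q.1 (fun t => opPow A (q.2 + 1) (u t)) (Ici t₀) t := fun q hq => by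
    rw [Finset.HasAntidiagonal.mem_antidiagonal] at hq
    exact hu.iteratedDerivWithin_opPow_succ hR (by omega) ht
  rw [parabolicLeibniz, opApply_sum _ fun q hq => nsmul_mem (hD q hq).1 _]
  refine Finset.sum_congr rfl fun q hq => ?_
  rw [opApply_nsmul _ (hD q hq).1, (hD q hq).2]

variable [CompleteSpace X]

/-- By induction, the Leibniz sum agrees almost everywhere, hence by continuity everywhere on J,
with a constant plus a primitive of the weak derivative v. So v is its classical derivative almost
everywhere, and adding the A-term raises j by one. -/
theorem parabolicLeibniz_ae_eq (hR : IsSemigroupResolvent S A z R)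
    (hu : IsMixedRegular A t₀ m u) {p : ℝ≥0∞} (hp : 1 ≤ p) {j : ℕ} (hj : j ≤ m) {g : ℝ → X}
    (hg : IsParabolicPow A p t₀ j u g) :
    g =ᵐ[volume.restrict (Ioi t₀)] parabolicLeibniz A t₀ u j := by
  induction j generalizing g with
  | zero =>
    refine hg.2.trans (Eventually.of_forall fun t => ?_)
    simp [parabolicLeibniz, opPow]
  | succ j ih =>
    obtain ⟨w, hw, hwMem, -, -, v, hv, hweak, hgv⟩ := hg.exists_last
    have hw' := ih (by omega) hw
    have hvE := ExpIntegrable.of_memLp hp hv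
    obtain ⟨c, hc⟩ := exists_ae_eq_const_add_primitive (ExpIntegrable.of_memLp hp hwMem) hvE hweak
    have heq : EqOn (parabolicLeibniz A t₀ u j) (fun t => c + volterra (idKernel X) t₀ v t)
        (Ioi t₀) :=
      Measure.eqOn_open_of_ae_eq (hw'.symm.trans hc) isOpen_Ioi
        ((hu.continuousOn_parabolicLeibniz (by omega)).mono Ioi_subset_Ici_self)
        (continuousOn_const.add (hvE.continuousOn_primitive.mono Ioi_subset_Ici_self))
    have hv' : ∀ᵐ t ∂volume.restrict (Ioi t₀), v t = ∑ q ∈ Finset.HasAntidiagonal.antidiagonal j,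
        j.choose q.1 • iteratedDerivWithin (q.1 + 1) (fun t => opPow A q.2 (u t)) (Ici t₀) t := by
      rw [ae_restrict_iff' measurableSet_Ioi]
      filter_upwards [LocallyIntegrable.ae_hasDerivAt_integral hvE.locallyIntegrable_indicator]
        with t ht htt
      have h1 := (ht t₀).const_add c
      rw [indicator_of_mem htt] at h1
      refine (h1.congr_of_eventuallyEq ?_).unique (hu.hasDerivAt_parabolicLeibniz (by omega) htt)
      filter_upwards [isOpen_Ioi.mem_nhds htt] with r hr
      rw [← volterra_idKernel_eq_intervalIntegral (le_of_lt hr)]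
      exact heq hr
    filter_upwards [hgv, hv', hw', ae_restrict_mem measurableSet_Ioi] with t h1 h2 h3 ht
    -- Pascal's rule merges the two sums. It comes with j choose l in one of them, hence the
    -- symmetry of binomial coefficients below.
    rw [h1, h2, h3, hu.opApply_parabolicLeibniz hR (by omega) (mem_Ici.2 (le_of_lt ht)), add_comm,
      parabolicLeibniz, Finset.sum_antidiagonal_choose_succ_nsmul
        (fun i l => iteratedDerivWithin i (fun t => opPow A l (u t)) (Ici t₀) t)]
    congr 1
    refine Finset.sum_congr rfl fun q hq => ?_
    rw [Nat.choose_symm_of_eq_add (Finset.HasAntidiagonal.mem_antidiagonal.1 hq).symm]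

end IsMixedRegular

/-- With r = t - t₀ and k = i + l, r^k / k! times k choose i is (r^i / i!)(r^l / l!). The triangle i
+ l ≤ N is then summed over l first, and S commutes with A^l on D(A^l). -/
theorem sum_powKernel_parabolicLeibniz (hR : IsSemigroupResolvent S A z R) {t₀ : ℝ} {N : ℕ}
    {u : ℝ → X} (hu : IsMixedRegular A t₀ N u) {t : ℝ} (ht : t₀ < t) :
    ∑ k ∈ Finset.range (N + 1), powKernel S (k + 1) (t - t₀) (parabolicLeibniz A t₀ u k t₀) =
      ∑ k ∈ Finset.range (N + 1), ((t - t₀) ^ k / (k.factorial : ℝ)) •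
        incGammaOp S A (N + 1 - k) (t - t₀) (iteratedDerivWithin k u (Ici t₀) t₀) := by
  have hr : 0 ≤ t - t₀ := sub_nonneg.2 ht.le
  set F : ℕ → ℕ → X := fun i l => ((t - t₀) ^ i / (i.factorial : ℝ)) •
    ((t - t₀) ^ l / (l.factorial : ℝ)) •
      S (t - t₀) (iteratedDerivWithin i (fun t => opPow A l (u t)) (Ici t₀) t₀) with hF
  have hL : ∀ k ∈ Finset.range (N + 1),
      powKernel S (k + 1) (t - t₀) (parabolicLeibniz A t₀ u k t₀) =
        ∑ i ∈ Finset.range (k + 1), F i (k - i) := by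
    intro k _
    rw [← Finset.Nat.sum_antidiagonal_eq_sum_range_succ F, parabolicLeibniz, map_sum]
    refine Finset.sum_congr rfl fun q hq => ?_
    rw [Finset.HasAntidiagonal.mem_antidiagonal] at hq
    simp only [hF, powKernel_apply, map_nsmul]
    rw [← Nat.cast_smul_eq_nsmul ℝ, smul_smul, smul_smul, add_sub_cancel_right, Real.rpow_natCast,
      Real.Gamma_nat_eq_factorial, ← hq, Nat.choose_symm_add, Nat.add_choose, pow_add]
    congr 1
    rw [Nat.cast_div (Nat.factorial_mul_factorial_dvd_factorial_add _ _) (by positivity)]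
    push_cast
    field_simp
  rw [Finset.sum_congr rfl hL, Finset.sum_range_diag_flip]
  refine Finset.sum_congr rfl fun i hi => ?_
  rw [incGammaOp, if_neg (sub_ne_zero.2 ht.ne'), Finset.smul_sum]
  refine Finset.sum_congr rfl fun l hl => ?_
  rw [Finset.mem_range] at hi hl
  have hdom : iteratedDerivWithin i u (Ici t₀) t₀ ∈ domPow A l := fun k hk =>
    hu.iteratedDerivWithin_mem_domPow hR self_mem_Ici k (by omega)
  rw [hR.opPow_semigroup hr hdom, hu.opPow_iteratedDerivWithin hR (by omega) self_mem_Ici]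

variable [CompleteSpace X]

theorem caputo_expansion (hR : IsSemigroupResolvent S A z R)
    (hS : IsMeasurableSemigroup S) (hb : IsUniformlyBounded S) {s : ℝ} (hs : 0 < s)
    (hsN : ∀ m : ℕ, s ≠ m) {t₀ : ℝ} {p : ℝ≥0∞} (hp : 1 ≤ p) {u f : ℝ → X}
    (h : IsCaputoDeriv S A p t₀ s u f) (hreg : IsMixedRegular A t₀ ⌊s⌋₊ u) :
    ∀ᵐ t ∂volume.restrict (Ioi t₀),
      IntegrableOn (fracIntegrand S s f t) (Ioo t₀ t) ∧
      fracInt S t₀ s f t =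
        u t - ∑ k ∈ Finset.range (⌊s⌋₊ + 1), ((t - t₀) ^ k / (k.factorial : ℝ)) •
          incGammaOp S A (⌈s⌉₊ - k) (t - t₀) (iteratedDerivWithin k u (Ici t₀) t₀) := by
  obtain ⟨g, hpow, hf⟩ := h
  have hθ := fract_pos_of_ne_natCast hs.le hsN
  have hθ1 := Int.fract_lt_one s
  have hsum := natCast_floor_add_fract hs.le
  have hceil := natCeil_eq_floor_add_one hs.le hsN
  have hα : 0 < 1 - Int.fract s := sub_pos.2 hθ1
  rw [hceil] at hpow hf ⊢
  rw [show (((⌊s⌋₊ + 1 : ℕ) : ℝ) - s) = 1 - Int.fract s by push_cast; linarith] at hf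
  have hg := ExpIntegrable.of_memLp hp hpow.memLp_right
  have hfE : ExpIntegrable t₀ f := (expIntegrable_fracInt hS hb hα.le hg).congr hf.symm
  obtain ⟨w, hw, hexp⟩ := hpow.exists_expansion hp hR hS hb
  have hw0 : ∀ k ∈ Finset.range (⌊s⌋₊ + 1), w k t₀ = parabolicLeibniz A t₀ u k t₀ := by
    intro k hk
    rw [Finset.mem_range] at hk
    have hae := hreg.parabolicLeibniz_ae_eq hR hp (Nat.le_of_lt_succ hk) (hw k hk).2
    -- Both functions are continuous up to t₀, so equality almost everywhere on the closed half-line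
    -- forces equality at the endpoint.
    rw [restrict_Ioi_eq_restrict_Ici] at hae
    exact Measure.eqOn_of_ae_eq hae (hw k hk).1
      (hreg.continuousOn_parabolicLeibniz (Nat.le_of_lt_succ hk)) (by simp) self_mem_Ici
  filter_upwards [ae_restrict_mem measurableSet_Ioi, hexp,
    ae_restrict_of_ae (ae_integrableOn_fracIntegrand hS hb hs hfE),
    ae_restrict_of_ae (volterra_powKernel_volterra_powKernel hS hb hs hα hg)] with t ht h1 h2 h3
  refine ⟨h2, ?_⟩
  rw [fracInt_eq_volterra S t₀ hα.ne'] at hf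
  rw [fracInt_eq_volterra S t₀ hs.ne', volterra_congr_ae hf, h3, h1,
    ← sum_powKernel_parabolicLeibniz hR hreg ht,
    Finset.sum_congr rfl fun k hk => by rw [hw0 k hk],
    fracInt_eq_volterra S t₀ (by positivity), add_sub_cancel_left]
  congr 2
  push_cast
  linarith

end Caputo

theorem proposition4p1 {X : Type*} [NormedAddCommGroup X] [NormedSpace ℂ X] [CompleteSpace X]
    (S : ℝ → X →L[ℂ] X) (A : X →ₗ.[ℂ] X)
    (hS : IsMeasurableSemigroup S) (hbdd : IsUniformlyBounded S) (hA : IsNegGenerator S A)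
    (s : ℝ) (hs : 0 < s) (hsN : ∀ m : ℕ, s ≠ m) (t₀ : ℝ) (p : ℝ≥0∞) (hp : 1 ≤ p) :
    -- the Riemann–Liouville case; `g k` is the continuous representative of
    -- the Riemann–Liouville integral (`k = 0`) or derivative (`k ≥ 1`) of order `k + {s} - 1`
    (∀ u f : ℝ → X, IsRLDeriv S A p t₀ s u f →
      ∃ g : ℕ → ℝ → X,
        (∀ k ≤ ⌊s⌋₊, ContinuousOn (g k) (Ici t₀)) ∧
        g 0 =ᵐ[volume.restrict (Ioi t₀)] fracInt S t₀ (1 - Int.fract s) u ∧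
        (∀ k : ℕ, 1 ≤ k → k ≤ ⌊s⌋₊ → IsRLDeriv S A p t₀ (k + Int.fract s - 1) u (g k)) ∧
        ∀ᵐ t ∂volume.restrict (Ioi t₀),
          IntegrableOn (fracIntegrand S s f t) (Ioo t₀ t) ∧
          fracInt S t₀ s f t =
            u t
            - ((t - t₀) ^ (Int.fract s - 1) / Real.Gamma (Int.fract s)) • S (t - t₀) (g 0 t₀)
            - ∑ k ∈ Finset.Icc 1 ⌊s⌋₊,
                ((t - t₀) ^ (k + Int.fract s - 1) / Real.Gamma (k + Int.fract s)) •
                  S (t - t₀) (g k t₀)) ∧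
    -- the Caputo case
    (∀ u f : ℝ → X, IsCaputoDeriv S A p t₀ s u f →
      (∀ j < ⌈s⌉₊, IsCkDomPow A t₀ j (⌈s⌉₊ - 1 - j) u) →
      (∀ k ≤ ⌊s⌋₊, iteratedDerivWithin k u (Ici t₀) t₀ ∈ domPow A (⌈s⌉₊ - k - 1)) ∧
      ∀ᵐ t ∂volume.restrict (Ioi t₀),
        IntegrableOn (fracIntegrand S s f t) (Ioo t₀ t) ∧
        fracInt S t₀ s f t =
          u t
          - ∑ k ∈ Finset.range (⌊s⌋₊ + 1),
              ((t - t₀) ^ k / (k.factorial : ℝ)) •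
                incGammaOp S A (⌈s⌉₊ - k) (t - t₀) (iteratedDerivWithin k u (Ici t₀) t₀)) := by
  obtain ⟨z, R, hR⟩ := exists_isSemigroupResolvent hS hbdd hA
  refine ⟨fun u f h => riemannLiouville_expansion hR hS hbdd hs hsN hp h, fun u f h hC => ?_⟩
  have hceil := natCeil_eq_floor_add_one hs.le hsN
  -- Membership in D(A^N) is the case j = 0; the mixed regularity for (i, l) is the case j = i.
  have hreg : IsMixedRegular A t₀ ⌊s⌋₊ u := by
    rw [hceil] at hC
    refine ⟨(hC 0 (Nat.succ_pos _)).1, fun i l hil => ?_⟩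
    exact (hC i (by omega)).2 l (by omega)
  refine ⟨fun k _ => ?_, caputo_expansion hR hS hbdd hs hsN hp h hreg⟩
  rw [hceil, show ⌊s⌋₊ + 1 - k - 1 = ⌊s⌋₊ - k by omega]
  exact hreg.iteratedDerivWithin_mem_domPow hR self_mem_Ici
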